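/- Let $\mathbb N=\{0,1,2,\dots\}$. Let $X$ be one of the complex Banach spaces $\ell_p(\mathbb N)$, $1\le p<\infty$, or $c_0(\mathbb N)$, with the coordinatewise product, and give $X^d$ the product topology and the product algebra structure. For a bounded sequence $w=(w_n)_{n\ge 1}$ of positive reals let $B_w(x_0,x_1,x_2,\dots)=(w_1x_1,w_2x_2,\dots)$ be the weighted backward shift on $X$, and let $B$ be the backward shift (all weights equal to $1$). For a family $(T_\lambda)_{\lambda\in\Lambda}$ of continuous linear operators on $X^d$, a common hypercyclic vector is a vector $x\in X^d$ such that $\{T_\lambda^n x : n\ge 1\}$ is dense in $X^d$ for every $\lambda\in\Lambda$; a common hypercyclic algebra is a (not necessarily unital) subalgebra $A\ne\{0\}$ of $X^d$ all of whose nonzero elements are common hypercyclic vectors for the family. (1) Let $d\ge 1$ and $\alpha\in(0,1]$, let $\Lambda\subset\mathbb R^d$ be $\sigma$-compact, and for $a\in\mathbb R$ let $w(a)=(w_n(a))_{n\ge1}$ be the weight sequence with $w_1(a)\cdots w_n(a)=\exp(a n^\alpha)$ for all $n\ge 1$. Then the following assertions are equivalent: (a) the family $(B_{w(\lambda(1))}\times\cdots\times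 B_{w(\lambda(d))})_{\lambda\in\Lambda}$ has a common hypercyclic vector in $X^d$; (b) the family $(B_{w(\lambda(1))}\times\cdots\times B_{w(\lambda(d))})_{\lambda\in\Lambda}$ has a common hypercyclic algebra in $X^d$. (2) Let $\Gamma\subset(1,+\infty)^2$ be a Lipschitz curve, that is, the image of a nonempty interval of $\mathbb R$ under a Lipschitz map. Then the family $(\lambda B\times\mu B)_{(\lambda,\mu)\in\Gamma}$ has a common hypercyclic vector and a common hypercyclic algebra in $X^2$. -/

import Mathlib

open scoped ENNReal NNReal ZeroAtInfty

noncomputable section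

namespace CommonHypercyclic

section Dynamics

variable {X : Type*} [TopologicalSpace X] [NonUnitalRing X] [Module ℂ X]

/-- `x` is a hypercyclic vector for `T`: the orbit `{T ^ n x : n ≥ 1}` is dense. -/
def IsHypercyclicVector (T : X →L[ℂ] X) (x : X) : Prop :=
  Dense {y : X | ∃ n : ℕ, 1 ≤ n ∧ (⇑T)^[n] x = y}

/-- The family `(T i)`, `i ∈ S`, has a common hypercyclic vector. -/
def HasCommonHypercyclicVector {ι : Type*} (S : Set ι) (T : ι → X →L[ℂ] X) : Prop :=
  ∃ x : X, ∀ i ∈ S, IsHypercyclicVector (T i) x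

/-- The family `(T i)`, `i ∈ S`, has a common hypercyclic algebra: a subalgebra `A ≠ {0}` of `X`
(not assumed to have a unit) all of whose nonzero elements are hypercyclic for every `T i`. -/
def HasCommonHypercyclicAlgebra {ι : Type*} (S : Set ι) (T : ι → X →L[ℂ] X) : Prop :=
  ∃ A : NonUnitalSubalgebra ℂ X, (∃ x ∈ A, x ≠ 0) ∧
    ∀ x ∈ A, x ≠ 0 → ∀ i ∈ S, IsHypercyclicVector (T i) x

/-- The product operator `T 0 × ⋯ × T (d - 1)` on `X ^ d`. -/
def prodOperator {d : ℕ} (T : Fin d → X →L[ℂ] X) : (Fin d → X) →L[ℂ] (Fin d → X) :=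
  ContinuousLinearMap.piMap T

end Dynamics

/-- A weight sequence `(w n)`, `n ≥ 1`, of positive reals that is admissible on `ℓ_p` and on `c_0`,
that is, bounded. The value `w 0` is never used. -/
structure AdmissibleWeight where
  toFun : ℕ → ℝ
  pos : ∀ n, 1 ≤ n → 0 < toFun n
  bounded : ∃ C : ℝ, ∀ n, 1 ≤ n → toFun n ≤ C

instance : CoeFun AdmissibleWeight (fun _ => ℕ → ℝ) := ⟨AdmissibleWeight.toFun⟩

lemma AdmissibleWeight.exists_norm_le (w : AdmissibleWeight) :
    ∃ C : ℝ, 0 ≤ C ∧ ∀ n, ‖((w (n + 1) : ℝ) : ℂ)‖ ≤ C := by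
  obtain ⟨C, hC⟩ := w.bounded
  refine ⟨C, (w.pos 1 le_rfl).le.trans (hC 1 le_rfl), fun n => ?_⟩
  rw [Complex.norm_real, Real.norm_of_nonneg (w.pos _ (by omega)).le]
  exact hC _ (by omega)

/-- The constant weight sequence `1`, whose weighted shift is the backward shift `B`. -/
def AdmissibleWeight.one : AdmissibleWeight where
  toFun _ := 1
  pos _ _ := one_pos
  bounded := ⟨1, fun _ _ => le_rfl⟩

section Ellp

/-- Complex `ℓ_p(ℕ)`. -/
abbrev Ellp (p : ℝ≥0∞) : Type := lp (fun _ : ℕ => ℂ) p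

variable {p : ℝ≥0∞}

lemma memℓp_mul {f g : ℕ → ℂ} (hf : Memℓp f p) (hg : Memℓp g p) (hp : p ≠ ∞) :
    Memℓp (fun n => f n * g n) p := by
  obtain ⟨C, hC⟩ := memℓp_infty_iff.1 (hf.of_exponent_ge le_top)
  rcases eq_or_ne p 0 with rfl | h0
  · rw [memℓp_zero_iff] at hg ⊢
    exact hg.subset fun n hn h => hn (by simp [h])
  · have hpos : 0 < p.toReal := ENNReal.toReal_pos h0 hp
    rw [memℓp_gen_iff hpos] at hg ⊢
    refine Summable.of_nonneg_of_le (fun n => by positivity) (fun n => ?_)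
      (hg.mul_left (C ^ p.toReal))
    have hCn : ‖f n‖ ≤ C := hC ⟨n, rfl⟩
    rw [norm_mul, Real.mul_rpow (norm_nonneg _) (norm_nonneg _)]
    gcongr

variable [Fact (p ≠ ∞)]

/-- The coordinatewise product on `ℓ_p`, `p < ∞`. -/
instance : Mul (Ellp p) := ⟨fun f g => ⟨fun n => f n * g n, memℓp_mul f.2 g.2 Fact.out⟩⟩

@[simp] lemma Ellp.mul_apply (f g : Ellp p) (n : ℕ) : (f * g) n = f n * g n := rfl

instance : NonUnitalCommRing (Ellp p) :=
  { (inferInstance : AddCommGroup (Ellp p)), (inferInstance : Mul (Ellp p)) with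
    left_distrib := fun a b c => lp.ext (funext fun n => mul_add (a n) (b n) (c n))
    right_distrib := fun a b c => lp.ext (funext fun n => add_mul (a n) (b n) (c n))
    zero_mul := fun a => lp.ext (funext fun n => zero_mul (a n))
    mul_zero := fun a => lp.ext (funext fun n => mul_zero (a n))
    mul_assoc := fun a b c => lp.ext (funext fun n => mul_assoc (a n) (b n) (c n))
    mul_comm := fun a b => lp.ext (funext fun n => mul_comm (a n) (b n)) }

lemma memℓp_shift (w : AdmissibleWeight) (f : Ellp p) (h1 : 1 ≤ p) :
    Memℓp (fun n => (w (n + 1) : ℂ) * f (n + 1)) p := by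
  obtain ⟨C, hC0, hC⟩ := w.exists_norm_le
  have hpos : 0 < p.toReal := ENNReal.toReal_pos (by positivity) Fact.out
  have hf := (memℓp_gen_iff hpos).1 f.2
  rw [memℓp_gen_iff hpos]
  refine Summable.of_nonneg_of_le (fun n => by positivity) (fun n => ?_)
    (((summable_nat_add_iff 1).2 hf).mul_left (C ^ p.toReal))
  rw [norm_mul, Real.mul_rpow (norm_nonneg _) (norm_nonneg _)]
  gcongr
  exact hC n

variable [Fact (1 ≤ p)]

/-- The weighted backward shift `(x_0, x_1, …) ↦ (w_1 x_1, w_2 x_2, …)` on `ℓ_p`. -/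
def shiftEllp (w : AdmissibleWeight) : Ellp p →L[ℂ] Ellp p :=
  LinearMap.mkContinuousOfExistsBound
    { toFun := fun f => ⟨fun n => (w (n + 1) : ℂ) * f (n + 1), memℓp_shift w f Fact.out⟩
      map_add' := fun f g => lp.ext (funext fun n => mul_add _ (f (n + 1)) (g (n + 1)))
      map_smul' := fun c f => lp.ext (funext fun n => mul_left_comm _ c (f (n + 1))) }
    (by
      obtain ⟨C, hC0, hC⟩ := w.exists_norm_le
      have hpos : 0 < p.toReal :=
        ENNReal.toReal_pos (one_pos.trans_le (Fact.out : 1 ≤ p)).ne' Fact.out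
      refine ⟨C, fun f => lp.norm_le_of_tsum_le hpos (by positivity) ?_⟩
      have hf := (memℓp_gen_iff hpos).1 f.2
      have hf1 := (summable_nat_add_iff 1).2 hf
      rw [Real.mul_rpow hC0 (norm_nonneg _), lp.norm_rpow_eq_tsum hpos, ← hf.sum_add_tsum_nat_add 1]
      have hle : ∀ n, ‖(w (n + 1) : ℂ) * f (n + 1)‖ ^ p.toReal
          ≤ C ^ p.toReal * ‖f (n + 1)‖ ^ p.toReal := fun n => by
        rw [norm_mul, Real.mul_rpow (norm_nonneg _) (norm_nonneg _)]
        gcongr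
        exact hC n
      calc ∑' n, ‖(w (n + 1) : ℂ) * f (n + 1)‖ ^ p.toReal
          ≤ ∑' n, C ^ p.toReal * ‖f (n + 1)‖ ^ p.toReal :=
            ((memℓp_gen_iff hpos).1 (memℓp_shift w f Fact.out)).tsum_le_tsum hle
              (hf1.mul_left _)
        _ = C ^ p.toReal * ∑' n, ‖f (n + 1)‖ ^ p.toReal := tsum_mul_left
        _ ≤ _ := by
            gcongr
            exact le_add_of_nonneg_left (Finset.sum_nonneg fun i _ => by positivity))

@[simp] lemma shiftEllp_apply (w : AdmissibleWeight) (f : Ellp p) (n : ℕ) :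
    shiftEllp w f n = (w (n + 1) : ℂ) * f (n + 1) := rfl

end Ellp

section Czero

/-- Complex `c_0(ℕ)`, with the coordinatewise product. -/
abbrev Czero : Type := C₀(ℕ, ℂ)

/-- The weighted backward shift `(x_0, x_1, …) ↦ (w_1 x_1, w_2 x_2, …)` on `c_0`. -/
def shiftCzero (w : AdmissibleWeight) : Czero →L[ℂ] Czero :=
  LinearMap.mkContinuousOfExistsBound
    { toFun := fun f =>
        { toFun := fun n => (w (n + 1) : ℂ) * f (n + 1)
          continuous_toFun := continuous_of_discreteTopology
          zero_at_infty' := by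
            obtain ⟨C, hC0, hC⟩ := w.exists_norm_le
            have hf := f.zero_at_infty'
            rw [Filter.cocompact_eq_cofinite, Nat.cofinite_eq_atTop] at hf ⊢
            refine squeeze_zero_norm (a := fun n => C * ‖f (n + 1)‖) (fun n => ?_) ?_
            · rw [norm_mul]
              gcongr
              exact hC n
            · simpa using ((hf.comp (Filter.tendsto_add_atTop_nat 1)).norm.const_mul C) }
      map_add' := fun f g => by ext n; exact mul_add _ (f (n + 1)) (g (n + 1))
      map_smul' := fun c f => by ext n; exact mul_left_comm _ c (f (n + 1)) }
    (by
      obtain ⟨C, hC0, hC⟩ := w.exists_norm_le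
      refine ⟨C, fun f => ?_⟩
      rw [← ZeroAtInftyContinuousMap.norm_toBCF_eq_norm]
      refine (BoundedContinuousFunction.norm_le (by positivity)).2 fun n => ?_
      refine (norm_mul_le _ _).trans ?_
      gcongr
      · exact hC n
      · rw [← ZeroAtInftyContinuousMap.norm_toBCF_eq_norm]
        exact f.toBCF.norm_coe_le_norm (n + 1))

@[simp] lemma shiftCzero_apply (w : AdmissibleWeight) (f : Czero) (n : ℕ) :
    shiftCzero w f n = (w (n + 1) : ℂ) * f (n + 1) := rfl

end Czero

/-- The weights `w_n(a) = exp (a (n ^ α - (n - 1) ^ α))`, `n ≥ 1`, which are the solution of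
`w_1(a) ⋯ w_n(a) = exp (a n ^ α)`; they witness that such admissible weights exist. -/
def expWeight (α : ℝ) (hα : α ∈ Set.Ioc (0 : ℝ) 1) (a : ℝ) : AdmissibleWeight where
  toFun n := Real.exp (a * ((n : ℝ) ^ α - ((n - 1 : ℕ) : ℝ) ^ α))
  pos _ _ := Real.exp_pos _
  bounded := by
    refine ⟨Real.exp |a|, fun n hn => Real.exp_le_exp.2 ?_⟩
    obtain ⟨k, rfl⟩ : ∃ k, n = k + 1 := ⟨n - 1, by omega⟩
    have h1 : ((k + 1 : ℕ) : ℝ) ^ α ≤ (k : ℝ) ^ α + 1 := by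
      have := Real.rpow_add_le_add_rpow (Nat.cast_nonneg k) zero_le_one hα.1.le hα.2
      simpa using this
    have h2 : (k : ℝ) ^ α ≤ ((k + 1 : ℕ) : ℝ) ^ α :=
      Real.rpow_le_rpow (Nat.cast_nonneg k) (by push_cast; linarith) hα.1.le
    rw [Nat.add_sub_cancel]
    refine (le_abs_self _).trans ?_
    rw [abs_mul, abs_of_nonneg (sub_nonneg.2 h2)]
    exact mul_le_of_le_one_right (abs_nonneg a) (by linarith)

lemma prod_expWeight (α : ℝ) (hα : α ∈ Set.Ioc (0 : ℝ) 1) (a : ℝ) (n : ℕ) :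
    ∏ k ∈ Finset.Icc 1 n, expWeight α hα a k = Real.exp (a * (n : ℝ) ^ α) := by
  induction n with
  | zero => simp [Real.zero_rpow hα.1.ne']
  | succ n ih =>
    rw [Finset.prod_Icc_succ_top (by omega), ih]
    change _ * Real.exp _ = _
    rw [← Real.exp_add, Nat.add_sub_cancel]
    congr 1
    ring

/-- A Lipschitz curve in the plane: the image of a (nonempty) real interval under a Lipschitz
map. -/
def IsLipschitzCurve (Γ : Set (Fin 2 → ℝ)) : Prop :=
  ∃ (J : Set ℝ) (f : ℝ → Fin 2 → ℝ) (K : ℝ≥0),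
    J.OrdConnected ∧ J.Nonempty ∧ LipschitzOnWith K f J ∧ f '' J = Γ

end CommonHypercyclic

end

/-!
Write `φ(n) = n ^ α`, so that the `n`-th power of the shift with parameter `a` multiplies the entry
of index `n + k` by `exp (a (φ(n+k) - φ(k)))` and moves it to the index `k`. Only a few properties
of `φ` matter (`IsGrowth`), and only solidity of the norm, contractivity of the forward shift and
density of the finitely supported sequences matter about `ℓ_p` and `c_0` (`SequenceAlgebra`).

The bridge between hypercyclic vectors and hypercyclic algebras is the notion of a coverable compact
set `K` of parameters (`Coverable`): finitely many late and widely separated times `n` carry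
parameters `μ n ∈ K` such that each `s ∈ K` is, for one of these times, within about `ε / φ(n)` of
`μ n`, and such that at this time the entries of size `exp (-μ_j φ(j))` placed at the later times `j`
are sent to a sequence of norm at most `ε`.

*Coverability gives an algebra* (`hasCommonHypercyclicAlgebra_of_coverable`). By Baire's theorem it
suffices to perturb a finitely supported `u` to `u + z` such that, for every `s ∈ K` and every
polynomial `x ^ (m+1) + ∑ c_j x ^ (m+2+j)` with bounded coefficients, some power of the shift sends
the polynomial of `u + z` close to a given finitely supported `v`
(`exists_near_of_coverable`). The vector `z` carries at each chosen time `n` a block of `(m+1)`-st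
roots of the entries of `v`, scaled by `exp (-μ n (φ(n+l) - φ(l)) / (m+1))`. Its power of exponent
`m + 1` behaves as in the construction of a hypercyclic vector
(`normBound_shift_blockSeq_pow_sub`), and since `z` is small, its higher powers are, entry by entry,
small multiples of that one, hence negligible by solidity. The algebra consists of the polynomials
without constant term in a generic vector.

*A hypercyclic vector gives coverability* (`coverable_of_isHypercyclicVector`). Given a common
hypercyclic vector `x`, choose the times at which some orbit comes close to the vector with entries
`e_0 + 2 e_N`, and compactness. The entry `1` at the index `0` shows that `x_n` has about the size
`exp (-μ n φ(n))` and locates the parameters within `ε / φ(n)`; smallness of the orbit off the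
indices `0` and `N` bounds the contribution of later times by the entries of `x` themselves. The
particular target forces the times to be more than `N` apart (`add_lt_of_two_hits`).

*Lipschitz curves* (`coverable_image_Icc`). Since `a B` has the weights `exp (log a)`, the family is
the case `φ(n) = n` with the parameters `log a`, which run through a Lipschitz curve again. A compact
arc of it is coverable directly, with times in arithmetic progression, because the harmonic series
diverges.
-/

noncomputable section

namespace CommonHypercyclic

/-! ### Solid sequence algebras -/

/-- A normed algebra of complex sequences under the coordinatewise product, with a solid norm
dominating the coordinates, containing the unit vectors (of norm at most `1`), on which the forward
shift is contractive, and in which the finitely supported sequences are dense. The spaces `ℓ_p`,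
`1 ≤ p < ∞`, and `c_0` are the examples of interest. -/
class SequenceAlgebra (X : Type*) [NonUnitalNormedRing X] [NormedSpace ℂ X] where
  /-- The sequence underlying an element of the space. -/
  coord : X →ₗ[ℂ] (ℕ → ℂ)
  coord_injective : Function.Injective coord
  coord_mul : ∀ x y n, coord (x * y) n = coord x n * coord y n
  norm_coord_le : ∀ x n, ‖coord x n‖ ≤ ‖x‖
  exists_coord_eq_of_le : ∀ (x : X) (f : ℕ → ℂ), (∀ n, ‖f n‖ ≤ ‖coord x n‖) →
    ∃ y, coord y = f ∧ ‖y‖ ≤ ‖x‖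
  exists_coord_eq_shift : ∀ x : X, ∃ y, coord y 0 = 0 ∧ (∀ n, coord y (n + 1) = coord x n) ∧
    ‖y‖ ≤ ‖x‖
  exists_coord_eq_single : ∀ n : ℕ, ∃ y, coord y = Pi.single n 1 ∧ ‖y‖ ≤ 1
  exists_finite_support_near : ∀ (x : X) (ε : ℝ), 0 < ε →
    ∃ y, (∃ N, ∀ n, N ≤ n → coord y n = 0) ∧ ‖x - y‖ < ε

section Instances

variable {p : ℝ≥0∞} [Fact (p ≠ ∞)] [Fact (1 ≤ p)]

lemma memEllp_of_le (x : Ellp p) (f : ℕ → ℂ) (h : ∀ n, ‖f n‖ ≤ ‖x n‖) : Memℓp f p := by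
  have hpos : 0 < p.toReal :=
    ENNReal.toReal_pos (one_pos.trans_le (Fact.out : 1 ≤ p)).ne' Fact.out
  have hx := (memℓp_gen_iff hpos).1 x.2
  exact (memℓp_gen_iff hpos).2 (Summable.of_nonneg_of_le (fun n => by positivity)
    (fun n => Real.rpow_le_rpow (norm_nonneg _) (h n) hpos.le) hx)

instance : NonUnitalNormedRing (Ellp p) :=
  { (inferInstance : NonUnitalCommRing (Ellp p)),
    (inferInstance : NormedAddCommGroup (Ellp p)) with
    norm_mul_le := fun x y => by
      have hp0 : p ≠ 0 := (one_pos.trans_le (Fact.out : 1 ≤ p)).ne'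
      have h := lp.norm_mono hp0 (x := x * y) (y := (‖x‖ : ℂ) • y) fun n => by
        change ‖x n * y n‖ ≤ ‖(‖x‖ : ℂ) * y n‖
        rw [norm_mul, norm_mul, Complex.norm_real, norm_norm]
        gcongr
        exact lp.norm_apply_le_norm hp0 x n
      rwa [norm_smul, Complex.norm_real, norm_norm] at h }

instance : SequenceAlgebra (Ellp p) where
  coord :=
    { toFun := fun f n => f n
      map_add' := fun _ _ => rfl
      map_smul' := fun _ _ => rfl }
  coord_injective x y h := lp.ext h
  coord_mul _ _ _ := rfl
  norm_coord_le x n := lp.norm_apply_le_norm (one_pos.trans_le (Fact.out : 1 ≤ p)).ne' x n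
  exists_coord_eq_of_le x f h :=
    ⟨⟨f, memEllp_of_le x f h⟩, rfl,
      lp.norm_mono (one_pos.trans_le (Fact.out : 1 ≤ p)).ne'
        (x := (⟨f, memEllp_of_le x f h⟩ : Ellp p)) h⟩
  exists_coord_eq_shift x := by
    have hpos : 0 < p.toReal :=
      ENNReal.toReal_pos (one_pos.trans_le (Fact.out : 1 ≤ p)).ne' Fact.out
    have hx := (memℓp_gen_iff hpos).1 x.2
    let f : ℕ → ℂ := fun n => Nat.casesOn n 0 fun k => x k
    have hf : Summable fun n => ‖f n‖ ^ p.toReal := (summable_nat_add_iff 1).1 hx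
    refine ⟨⟨f, (memℓp_gen_iff hpos).2 hf⟩, rfl, fun _ => rfl, ?_⟩
    refine lp.norm_le_of_tsum_le hpos (norm_nonneg _) ?_
    rw [lp.norm_rpow_eq_tsum hpos]
    change ∑' n, ‖f n‖ ^ p.toReal ≤ _
    rw [hf.tsum_eq_zero_add]
    simp [f, Real.zero_rpow hpos.ne']
  exists_coord_eq_single n := by
    refine ⟨lp.single p n 1, ?_, ?_⟩
    · exact lp.coeFn_single p n 1
    · rw [lp.norm_single (one_pos.trans_le (Fact.out : 1 ≤ p)), norm_one]
  exists_finite_support_near x ε hε := by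
    have h := (lp.hasSum_single (Fact.out : p ≠ ∞) x).tendsto_sum_nat
    obtain ⟨N, hN⟩ := (Metric.tendsto_atTop.1 h) ε hε
    refine ⟨_, ⟨N, fun n hn => ?_⟩, by rw [← dist_eq_norm, dist_comm]; exact hN N le_rfl⟩
    change (∑ i ∈ Finset.range N, lp.single p i (x i) : Ellp p) n = 0
    rw [lp.coeFn_sum, Finset.sum_apply]
    refine Finset.sum_eq_zero fun i hi => ?_
    rw [lp.coeFn_single, Pi.single_eq_of_ne]
    have := Finset.mem_range.1 hi
    omega

/-- The element of `c_0` given by a null sequence. -/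
def Czero.ofTendsto (f : ℕ → ℂ) (h : Filter.Tendsto f Filter.atTop (nhds 0)) : Czero where
  toFun := f
  continuous_toFun := continuous_of_discreteTopology
  zero_at_infty' := by rwa [Filter.cocompact_eq_cofinite, Nat.cofinite_eq_atTop]

lemma Czero.tendsto (x : Czero) : Filter.Tendsto x Filter.atTop (nhds 0) := by
  have := x.zero_at_infty'
  rwa [Filter.cocompact_eq_cofinite, Nat.cofinite_eq_atTop] at this

lemma Czero.norm_apply_le (x : Czero) (n : ℕ) : ‖x n‖ ≤ ‖x‖ := by
  rw [← ZeroAtInftyContinuousMap.norm_toBCF_eq_norm]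
  exact x.toBCF.norm_coe_le_norm n

lemma Czero.norm_le (x : Czero) {C : ℝ} (hC : 0 ≤ C) (h : ∀ n, ‖x n‖ ≤ C) : ‖x‖ ≤ C := by
  rw [← ZeroAtInftyContinuousMap.norm_toBCF_eq_norm]
  exact (BoundedContinuousFunction.norm_le hC).2 h

instance : SequenceAlgebra Czero where
  coord :=
    { toFun := fun f n => f n
      map_add' := fun _ _ => rfl
      map_smul' := fun _ _ => rfl }
  coord_injective x y h := DFunLike.coe_injective h
  coord_mul _ _ _ := rfl
  norm_coord_le := Czero.norm_apply_le
  exists_coord_eq_of_le x f h :=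
    ⟨Czero.ofTendsto f (squeeze_zero_norm h (by simpa using x.tendsto.norm)), rfl,
      Czero.norm_le _ (norm_nonneg _) fun n => (h n).trans (x.norm_apply_le n)⟩
  exists_coord_eq_shift x := by
    let f : ℕ → ℂ := fun n => Nat.casesOn n 0 fun k => x k
    refine ⟨Czero.ofTendsto f ((Filter.tendsto_add_atTop_iff_nat 1).1 x.tendsto), rfl,
      fun _ => rfl, Czero.norm_le _ (norm_nonneg _) fun n => ?_⟩
    cases n with
    | zero => exact (norm_zero (E := ℂ)).le.trans (norm_nonneg _)
    | succ k => exact x.norm_apply_le k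
  exists_coord_eq_single n := by
    refine ⟨Czero.ofTendsto (Pi.single n 1) ?_, rfl, Czero.norm_le _ zero_le_one fun k => ?_⟩
    · refine tendsto_const_nhds.congr' ?_
      filter_upwards [Filter.eventually_gt_atTop n] with k hk
      rw [Pi.single_eq_of_ne hk.ne']
    · change ‖(Pi.single n 1 : ℕ → ℂ) k‖ ≤ 1
      rcases eq_or_ne k n with rfl | h
      · simp
      · simp [Pi.single_eq_of_ne h]
  exists_finite_support_near x ε hε := by
    obtain ⟨N, hN⟩ := Metric.tendsto_atTop.1 x.tendsto (ε / 2) (half_pos hε)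
    refine ⟨Czero.ofTendsto (fun n => if n < N then x n else 0) ?_, ⟨N, fun n hn => ?_⟩, ?_⟩
    · refine tendsto_const_nhds.congr' ?_
      filter_upwards [Filter.eventually_ge_atTop N] with k hk
      rw [if_neg hk.not_gt]
    · exact if_neg hn.not_gt
    · refine (Czero.norm_le _ (half_pos hε).le fun n => ?_).trans_lt (half_lt_self hε)
      change ‖x n - (if n < N then x n else 0)‖ ≤ _
      split_ifs with h
      · simpa using (half_pos hε).le
      · simpa using (hN n (not_lt.1 h)).le

end Instances

section Bounds

variable {X : Type*} [NonUnitalNormedRing X] [NormedSpace ℂ X] [SequenceAlgebra X]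

open SequenceAlgebra

variable (X) in
/-- The sequence `f` belongs to `X` and has norm at most `c` there. -/
def NormBound (f : ℕ → ℂ) (c : ℝ) : Prop := ∃ y : X, coord y = f ∧ ‖y‖ ≤ c

lemma normBound_coord (x : X) : NormBound X (coord x) ‖x‖ := ⟨x, rfl, le_rfl⟩

lemma NormBound.mono {f g : ℕ → ℂ} {c c' : ℝ} (hg : NormBound X g c) (h : ∀ n, ‖f n‖ ≤ ‖g n‖)
    (hc : c ≤ c') : NormBound X f c' := by
  obtain ⟨y, rfl, hy⟩ := hg
  obtain ⟨z, hz, hzy⟩ := exists_coord_eq_of_le y f h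
  exact ⟨z, hz, hzy.trans (hy.trans hc)⟩

lemma NormBound.norm_le {x : X} {c : ℝ} (h : NormBound X (coord x) c) : ‖x‖ ≤ c := by
  obtain ⟨y, hy, hc⟩ := h
  rwa [← coord_injective hy]

lemma NormBound.add {f g : ℕ → ℂ} {c c' : ℝ} (hf : NormBound X f c) (hg : NormBound X g c') :
    NormBound X (f + g) (c + c') := by
  obtain ⟨y, rfl, hy⟩ := hf
  obtain ⟨z, rfl, hz⟩ := hg
  exact ⟨y + z, map_add _ _ _, (norm_add_le _ _).trans (add_le_add hy hz)⟩

lemma NormBound.smul {f : ℕ → ℂ} {c : ℝ} (hf : NormBound X f c) (a : ℂ) :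
    NormBound X (a • f) (‖a‖ * c) := by
  obtain ⟨y, rfl, hy⟩ := hf
  exact ⟨a • y, map_smul _ _ _, (norm_smul_le _ _).trans (by gcongr)⟩

lemma normBound_zero : NormBound X 0 0 := ⟨0, map_zero _, norm_zero.le⟩

lemma NormBound.sum {ι : Type*} (s : Finset ι) {f : ι → ℕ → ℂ} {c : ι → ℝ}
    (h : ∀ i ∈ s, NormBound X (f i) (c i)) :
    NormBound X (∑ i ∈ s, f i) (∑ i ∈ s, c i) := by
  classical
  induction s using Finset.induction_on with
  | empty => simpa using normBound_zero
  | insert i s hi ih =>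
    rw [Finset.sum_insert hi, Finset.sum_insert hi]
    exact (h i (Finset.mem_insert_self i s)).add
      (ih fun j hj => h j (Finset.mem_insert_of_mem hj))

lemma normBound_single (n : ℕ) (a : ℂ) : NormBound X (Pi.single n a) ‖a‖ := by
  obtain ⟨y, hy, h1⟩ := exists_coord_eq_single (X := X) n
  refine ⟨a • y, ?_, (norm_smul_le _ _).trans (mul_le_of_le_one_right (norm_nonneg _) h1)⟩
  rw [map_smul, hy, ← Pi.single_smul, smul_eq_mul, mul_one]

lemma NormBound.shift {f : ℕ → ℂ} {c : ℝ} (hf : NormBound X f c) (l : ℕ) :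
    NormBound X (fun k => if l ≤ k then f (k - l) else 0) c := by
  induction l with
  | zero => simpa using hf
  | succ l ih =>
    obtain ⟨y, hy, hc⟩ := ih
    obtain ⟨z, hz0, hz, hzy⟩ := exists_coord_eq_shift y
    refine ⟨z, funext fun k => ?_, hzy.trans hc⟩
    cases k with
    | zero => simpa using hz0
    | succ k => rw [hz, hy]; simp

lemma dense_finite_support :
    Dense {y : X | ∃ N, ∀ n, N ≤ n → coord y n = 0} := fun x =>
  Metric.mem_closure_iff.2 fun ε hε => by
    obtain ⟨y, hy, h⟩ := exists_finite_support_near x ε hε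
    exact ⟨y, hy, by rwa [dist_eq_norm]⟩

variable (X) in
lemma SequenceAlgebra.separableSpace : TopologicalSpace.SeparableSpace X := by
  choose e he _ using fun n => exists_coord_eq_single (X := X) n
  have hs : TopologicalSpace.IsSeparable (Submodule.span ℂ (Set.range e) : Set X) :=
    (Set.countable_range e).isSeparable.span
  refine TopologicalSpace.isSeparable_univ_iff.1 (hs.closure.mono fun x _ => ?_)
  refine closure_mono ?_ (dense_finite_support x)
  rintro y ⟨N, hN⟩
  have : y = ∑ n ∈ Finset.range N, coord y n • e n := by
    refine coord_injective (funext fun k => ?_)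
    simp only [map_sum, map_smul, he, Finset.sum_apply, Pi.smul_apply, Pi.single_apply,
      smul_eq_mul, mul_ite, mul_one, mul_zero]
    by_cases hk : k < N
    · simp [hk]
    · simp [hk, hN k (not_lt.1 hk)]
  rw [this]
  exact Submodule.sum_mem _ fun n _ => Submodule.smul_mem _ _ (Submodule.subset_span ⟨n, rfl⟩)

lemma SequenceAlgebra.nontrivial : Nontrivial X := by
  obtain ⟨y, hy, _⟩ := exists_coord_eq_single (X := X) 0
  refine ⟨y, 0, fun h => ?_⟩
  have := congrFun hy 0
  simp [h] at this

end Bounds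

/-! ### Families of weighted shifts with exponential weights -/

/-- The properties of `φ n = n ^ α`, `0 < α ≤ 1`, on which the arguments about shifts with
`w_1(a) ⋯ w_n(a) = exp (a φ(n))` depend. -/
structure IsGrowth (φ : ℕ → ℝ) : Prop where
  zero : φ 0 = 0
  mono : Monotone φ
  add_le : ∀ m n, φ (m + n) ≤ φ m + φ n
  one_le : φ 1 ≤ 1
  summable : ∀ a : ℝ, 0 < a → Summable fun n => Real.exp (-(a * φ n))

namespace IsGrowth

variable {φ : ℕ → ℝ}

lemma nonneg (hφ : IsGrowth φ) (n : ℕ) : 0 ≤ φ n := by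
  rw [← hφ.zero]
  exact hφ.mono n.zero_le

lemma le_self (hφ : IsGrowth φ) (n : ℕ) : φ n ≤ n := by
  induction n with
  | zero => simp [hφ.zero]
  | succ n ih =>
    have := hφ.add_le n 1
    push_cast
    linarith [hφ.one_le]

lemma le_of_le (hφ : IsGrowth φ) {n N : ℕ} (h : n ≤ N) : φ n ≤ N :=
  (hφ.mono h).trans (hφ.le_self N)

end IsGrowth

lemma isGrowth_rpow {α : ℝ} (hα : α ∈ Set.Ioc (0 : ℝ) 1) : IsGrowth fun n : ℕ => (n : ℝ) ^ α where
  zero := by simp [Real.zero_rpow hα.1.ne']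
  mono m n h := Real.rpow_le_rpow (Nat.cast_nonneg m) (Nat.cast_le.2 h) hα.1.le
  add_le m n := by
    push_cast
    exact Real.rpow_add_le_add_rpow (Nat.cast_nonneg m) (Nat.cast_nonneg n) hα.1.le hα.2
  one_le := by simp
  summable a ha := by
    have h1 : Filter.Tendsto (fun n : ℕ => (n : ℝ) ^ α) Filter.atTop Filter.atTop :=
      (tendsto_rpow_atTop hα.1).comp tendsto_natCast_atTop_atTop
    have h2 := (isLittleO_exp_neg_mul_rpow_atTop ha (-2 / α)).comp_tendsto h1
    have h3 : Summable fun n : ℕ => ((n : ℝ) ^ α) ^ (-2 / α) := by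
      have : ∀ n : ℕ, ((n : ℝ) ^ α) ^ (-2 / α) = (n : ℝ) ^ (-2 : ℝ) := fun n => by
        rw [← Real.rpow_mul (Nat.cast_nonneg n), mul_div_cancel₀ _ hα.1.ne']
      simp only [this]
      exact Real.summable_nat_rpow.2 (by norm_num)
    refine summable_of_isBigO_nat h3 (h2.isBigO.congr_left fun n => ?_)
    simp [neg_mul]

lemma isGrowth_natCast : IsGrowth fun n : ℕ => (n : ℝ) := by
  simpa using isGrowth_rpow (α := 1) ⟨one_pos, le_rfl⟩

lemma prodOperator_iterate {X : Type*} [TopologicalSpace X] [NonUnitalRing X] [Module ℂ X]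
    {d : ℕ} (T : Fin d → X →L[ℂ] X) (n : ℕ) (x : Fin d → X) (i : Fin d) :
    (⇑(prodOperator T))^[n] x i = (T i)^[n] (x i) := by
  induction n generalizing x with
  | zero => rfl
  | succ n ih => rw [Function.iterate_succ_apply, Function.iterate_succ_apply, ih]; rfl

open SequenceAlgebra

section ShiftFamily

variable {X : Type*} [NonUnitalNormedRing X] [NormedSpace ℂ X] [SequenceAlgebra X]

/-- `T a` is the weighted backward shift whose weights satisfy `w_1 ⋯ w_n = exp (a φ(n))`. -/
def IsShiftFamily (φ : ℕ → ℝ) (T : ℝ → X →L[ℂ] X) : Prop :=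
  ∀ a x k, coord (T a x) k = (Real.exp (a * (φ (k + 1) - φ k)) : ℂ) * coord x (k + 1)

lemma IsShiftFamily.coord_iterate {φ : ℕ → ℝ} {T : ℝ → X →L[ℂ] X} (hT : IsShiftFamily φ T)
    (a : ℝ) (n : ℕ) (x : X) (k : ℕ) :
    coord ((T a)^[n] x) k = (Real.exp (a * (φ (n + k) - φ k)) : ℂ) * coord x (n + k) := by
  induction n generalizing x with
  | zero => simp
  | succ n ih =>
    rw [Function.iterate_succ_apply, ih, hT, ← mul_assoc, ← Complex.ofReal_mul, ← Real.exp_add,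
      show n + 1 + k = n + k + 1 by ring]
    ring_nf

/-- Passing from `a` to `b` multiplies each weight by `exp ((b - a) s)` with `s ∈ [0, 1]`, so that
`‖T b - T a‖ ≤ (exp |b - a| - 1) ‖T a‖`. -/
lemma IsShiftFamily.continuous {φ : ℕ → ℝ} (hφ : IsGrowth φ) {T : ℝ → X →L[ℂ] X}
    (hT : IsShiftFamily φ T) : Continuous T := by
  refine continuous_iff_continuousAt.2 fun a => ?_
  have key : ∀ b, ‖T b - T a‖ ≤ (Real.exp |b - a| - 1) * ‖T a‖ := fun b => by
    have h0 : 0 ≤ Real.exp |b - a| - 1 := sub_nonneg.2 (Real.one_le_exp (abs_nonneg _))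
    refine ContinuousLinearMap.opNorm_le_bound _ (by positivity) fun x => ?_
    rw [mul_assoc]
    refine NormBound.norm_le (X := X) ?_
    have hb := (normBound_coord (T a x)).smul ((Real.exp |b - a| - 1 : ℝ) : ℂ)
    refine hb.mono (fun k => ?_) ?_
    · rw [Pi.smul_apply, smul_eq_mul, norm_mul, sub_apply, map_sub,
        Pi.sub_apply, hT, hT]
      have hs0 : 0 ≤ φ (k + 1) - φ k := sub_nonneg.2 (hφ.mono k.le_succ)
      have hs1 : φ (k + 1) - φ k ≤ 1 := by linarith [hφ.add_le k 1, hφ.one_le]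
      set s := φ (k + 1) - φ k
      have h1 : Real.exp (b * s) = Real.exp ((b - a) * s) * Real.exp (a * s) := by
        rw [← Real.exp_add]; ring_nf
      rw [h1, Complex.ofReal_mul, mul_assoc, ← sub_one_mul, norm_mul]
      gcongr
      rw [← Complex.ofReal_one, ← Complex.ofReal_sub, Complex.norm_real,
        Complex.norm_real, Real.norm_of_nonneg h0, Real.norm_eq_abs]
      have h2 : |(b - a) * s| ≤ |b - a| := by
        rw [abs_mul, abs_of_nonneg hs0]
        exact mul_le_of_le_one_right (abs_nonneg _) hs1
      have h3 := abs_le.1 h2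
      have h4 : Real.exp ((b - a) * s) ≤ Real.exp |b - a| := Real.exp_le_exp.2 h3.2
      have h5 : Real.exp (-|b - a|) ≤ Real.exp ((b - a) * s) := Real.exp_le_exp.2 h3.1
      have h6 := Real.add_one_le_exp (|b - a|)
      have h7 := Real.add_one_le_exp (-|b - a|)
      exact abs_le.2 ⟨by linarith, by linarith⟩
    · rw [Complex.norm_real, Real.norm_of_nonneg h0]
      gcongr
      exact (T a).le_opNorm x
  refine tendsto_iff_norm_sub_tendsto_zero.2 (squeeze_zero (fun _ => norm_nonneg _) key ?_)
  have : Continuous fun b : ℝ => (Real.exp |b - a| - 1) * ‖T a‖ := by fun_prop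
  simpa using this.tendsto a

lemma IsShiftFamily.continuous_iterate {φ : ℕ → ℝ} (hφ : IsGrowth φ) {T : ℝ → X →L[ℂ] X}
    (hT : IsShiftFamily φ T) (n : ℕ) : Continuous fun q : ℝ × X => (T q.1)^[n] q.2 := by
  induction n with
  | zero => exact continuous_snd
  | succ n ih =>
    simp only [Function.iterate_succ_apply']
    exact ((hT.continuous hφ).comp continuous_fst).clm_apply ih

end ShiftFamily

/-! ### Polynomials of lowest degree coefficient one -/

section LowPoly

variable {X : Type*} [NonUnitalNormedRing X]

/-- The power `x ^ (n + 1)` in a ring without unit. -/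
def succPow (x : X) : ℕ → X
  | 0 => x
  | n + 1 => succPow x n * x

lemma continuous_succPow (n : ℕ) : Continuous fun x : X => succPow x n := by
  induction n with
  | zero => exact continuous_id
  | succ n ih => exact ih.mul continuous_id

variable [NormedSpace ℂ X]

/-- The polynomial `x ^ (m + 1) + ∑ j, c j • x ^ (m + 2 + j)`. Up to a nonzero scalar, every
nonzero polynomial without constant term has this form. -/
def lowPoly (m : ℕ) {D : ℕ} (c : Fin D → ℂ) (x : X) : X :=
  succPow x m + ∑ j : Fin D, c j • succPow x (m + 1 + j)

lemma continuous_lowPoly (m D : ℕ) :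
    Continuous fun q : (Fin D → ℂ) × X => lowPoly m q.1 q.2 := by
  have := fun n => continuous_succPow (X := X) n
  unfold lowPoly
  refine ((this m).comp continuous_snd).add (continuous_finsetSum _ fun j _ => ?_)
  exact ((continuous_apply j).comp continuous_fst).smul ((this _).comp continuous_snd)

variable [SequenceAlgebra X]

lemma coord_succPow (x : X) (n k : ℕ) : coord (succPow x n) k = coord x k ^ (n + 1) := by
  induction n with
  | zero => simp [succPow]
  | succ n ih => rw [succPow, coord_mul, ih, ← pow_succ]

lemma coord_lowPoly (m : ℕ) {D : ℕ} (c : Fin D → ℂ) (x : X) (k : ℕ) :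
    coord (lowPoly m c x) k
      = coord x k ^ (m + 1) * (1 + ∑ j : Fin D, c j * coord x k ^ ((j : ℕ) + 1)) := by
  simp only [lowPoly, map_add, map_sum, map_smul, Pi.add_apply, Finset.sum_apply, Pi.smul_apply,
    coord_succPow, smul_eq_mul, mul_add, mul_one, Finset.mul_sum]
  congr 1
  exact Finset.sum_congr rfl fun j _ => by ring

end LowPoly

/-! ### Coverable parameter sets and the perturbing block vectors -/

/-- The weight by which `x_{n+k}` is multiplied in `T λ ^ n x`, times the size
`exp (-μ_{n+k} φ(n+k))` that the vector to be built has at a time `n + k ∈ F`; it is `0` when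
`k = 0` or `n + k ∉ F`. This is what the later times of `F` contribute at time `n`. -/
def tailSeq (φ : ℕ → ℝ) (F : Finset ℕ) (μ : ℕ → ℝ) (s : ℝ) (n k : ℕ) : ℝ :=
  if k ≠ 0 ∧ n + k ∈ F then Real.exp (s * (φ (n + k) - φ k) - μ (n + k) * φ (n + k)) else 0

lemma tailSeq_nonneg (φ : ℕ → ℝ) (F : Finset ℕ) (μ : ℕ → ℝ) (s : ℝ) (n k : ℕ) :
    0 ≤ tailSeq φ F μ s n k := by
  unfold tailSeq
  split_ifs
  · exact (Real.exp_pos _).le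
  · exact le_rfl

/-- `K` is covered by finitely many parameter boxes around points `μ n ∈ K`, the box of `μ n` having
side about `ε / φ(n)`, where the times `n` are late and far apart, in such a way that at time `n`
and for a parameter in the box of `μ n` the later times contribute little. -/
def Coverable (X : Type*) [NonUnitalNormedRing X] [NormedSpace ℂ X] [SequenceAlgebra X]
    {d : ℕ} (φ : ℕ → ℝ) (K : Set (Fin d → ℝ)) : Prop :=
  ∀ (N n₀ : ℕ) (ε : ℝ), 1 ≤ N → 0 < ε → ∃ (F : Finset ℕ) (μ : ℕ → Fin d → ℝ),
    (∀ n ∈ F, n₀ ≤ n) ∧ (∀ n ∈ F, μ n ∈ K) ∧ (∀ n ∈ F, ∀ n' ∈ F, n < n' → n + N ≤ n') ∧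
    ∀ s ∈ K, ∃ n ∈ F, ∀ i, |Real.exp ((s i - μ n i) * φ n) - 1| ≤ ε ∧
      NormBound X (fun k => (tailSeq φ F (fun j => μ j i) (s i) n k : ℂ)) ε

/-- The sequence with the entries `r l * exp (-μ n (φ(n+l) - φ(l)) / q)`, `l < N`, at the positions
`n + l`, `n ∈ F`. When `r l ^ q = v l`, applying to its `q`-th power the `n`-th power of the shift
of parameter `μ n` reproduces `v` in the first `N` coordinates. -/
def blockSeq (φ : ℕ → ℝ) (F : Finset ℕ) (N : ℕ) (μ : ℕ → ℝ) (r : ℕ → ℂ) (q : ℕ) : ℕ → ℂ :=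
  ∑ n ∈ F, ∑ l ∈ Finset.range N,
    Pi.single (n + l) (r l * (Real.exp (-(μ n * (φ (n + l) - φ l) / q)) : ℂ))

section Block

variable {φ : ℕ → ℝ} {F : Finset ℕ} {N : ℕ} {μ : ℕ → ℝ} {r : ℕ → ℂ} {q : ℕ}

lemma blockSeq_apply (hF : ∀ n ∈ F, ∀ n' ∈ F, n < n' → n + N ≤ n') {n l : ℕ} (hn : n ∈ F)
    (hl : l < N) :
    blockSeq φ F N μ r q (n + l)
      = r l * (Real.exp (-(μ n * (φ (n + l) - φ l) / q)) : ℂ) := by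
  simp only [blockSeq, Finset.sum_apply]
  rw [Finset.sum_eq_single n, Finset.sum_eq_single l]
  · rw [Pi.single_eq_same]
  · intro l' _ hl'
    rw [Pi.single_eq_of_ne]
    omega
  · intro h
    exact absurd (Finset.mem_range.2 hl) h
  · intro n' hn' hne
    refine Finset.sum_eq_zero fun l' hl' => ?_
    rw [Pi.single_eq_of_ne]
    have h1 := Finset.mem_range.1 hl'
    rcases lt_or_gt_of_ne hne with h | h
    · have := hF n' hn' n hn h
      omega
    · have := hF n hn n' hn' h
      omega
  · intro h
    exact absurd hn h

lemma exists_of_blockSeq_ne_zero {k : ℕ} (h : blockSeq φ F N μ r q k ≠ 0) :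
    ∃ n ∈ F, ∃ l < N, k = n + l := by
  simp only [blockSeq, Finset.sum_apply] at h
  obtain ⟨n, hn, h⟩ := Finset.exists_ne_zero_of_sum_ne_zero h
  obtain ⟨l, hl, h⟩ := Finset.exists_ne_zero_of_sum_ne_zero h
  refine ⟨n, hn, l, Finset.mem_range.1 hl, ?_⟩
  by_contra hk
  exact h (Pi.single_eq_of_ne hk _)

variable {X : Type*} [NonUnitalNormedRing X] [NormedSpace ℂ X] [SequenceAlgebra X]

lemma normBound_blockSeq (hφ : IsGrowth φ) {a b ρ : ℝ} (ha : 0 ≤ a)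
    (hμ : ∀ n ∈ F, a ≤ μ n ∧ μ n ≤ b) (hρ : 0 ≤ ρ) (hr : ∀ l < N, ‖r l‖ ≤ ρ) (hq : 1 ≤ q) :
    NormBound X (blockSeq φ F N μ r q)
      (N * ρ * Real.exp (b * N) * ∑ n ∈ F, Real.exp (-(a / q * φ n))) := by
  have hq' : (1 : ℝ) ≤ q := by exact_mod_cast hq
  have hq0 : (0 : ℝ) < q := by linarith
  have h : NormBound X (blockSeq φ F N μ r q) (∑ n ∈ F, ∑ l ∈ Finset.range N,
      ‖r l * (Real.exp (-(μ n * (φ (n + l) - φ l) / q)) : ℂ)‖) :=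
    NormBound.sum _ fun n _ => NormBound.sum _ fun l _ => normBound_single _ _
  refine h.mono (fun _ => le_rfl) ?_
  rw [Finset.mul_sum]
  refine Finset.sum_le_sum fun n hn => ?_
  have : (N : ℝ) * ρ * Real.exp (b * N) * Real.exp (-(a / q * φ n))
      = ∑ l ∈ Finset.range N, ρ * (Real.exp (b * N) * Real.exp (-(a / q * φ n))) := by
    rw [Finset.sum_const, Finset.card_range, nsmul_eq_mul]
    ring
  rw [this]
  refine Finset.sum_le_sum fun l hl => ?_
  have hl := Finset.mem_range.1 hl
  rw [norm_mul, Complex.norm_real, Real.norm_of_nonneg (Real.exp_pos _).le, ← Real.exp_add]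
  obtain ⟨h1, h2⟩ := hμ n hn
  have h3 : φ n ≤ φ (n + l) := hφ.mono (Nat.le_add_right n l)
  have h4 : φ l ≤ N := hφ.le_of_le hl.le
  have h0 := hφ.nonneg n
  gcongr
  · exact hr l hl
  · have e1 : -(μ n * (φ (n + l) - φ l) / q) = (μ n * φ l - μ n * φ (n + l)) / q := by ring
    have e2 : a / q * φ n = a * φ n / q := by ring
    have e3 : b * N ≥ b * N / q := div_le_self (by have := ha.trans (h1.trans h2); positivity) hq'
    have e4 : (μ n * φ l - μ n * φ (n + l)) / q ≤ (b * N - a * φ n) / q := by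
      have f1 := mul_le_mul h2 h4 (hφ.nonneg l) (ha.trans (h1.trans h2))
      have f2 := mul_le_mul h1 h3 h0 (ha.trans h1)
      gcongr ?_ / _
      linarith
    rw [e1, e2]
    rw [sub_div _ (a * φ n)] at e4
    linarith

lemma abs_exp_sub_one_le_of_between {t y Δ : ℝ} (h0 : 0 ≤ Δ) (h1 : Δ ≤ y) :
    |Real.exp (t * Δ) - 1| ≤ |Real.exp (t * y) - 1| := by
  rcases le_total 0 t with ht | ht
  · have e1 : Real.exp (t * Δ) ≤ Real.exp (t * y) := Real.exp_le_exp.2 (by gcongr)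
    have e2 : 1 ≤ Real.exp (t * Δ) := Real.one_le_exp (by positivity)
    rw [abs_of_nonneg (by linarith), abs_of_nonneg (by linarith)]
    linarith
  · have e1 : Real.exp (t * y) ≤ Real.exp (t * Δ) :=
      Real.exp_le_exp.2 (mul_le_mul_of_nonpos_left h1 ht)
    have e2 : Real.exp (t * Δ) ≤ 1 :=
      Real.exp_le_one_iff.2 (mul_nonpos_of_nonpos_of_nonneg ht h0)
    rw [abs_of_nonpos (by linarith), abs_of_nonpos (by linarith)]
    linarith

/-- At the time `n` of the box containing the parameter `s`, the shift of the `q`-th power of the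
block sequence is close to `v`: the block of `n` reproduces `v` approximately, earlier blocks have
been shifted away, and later blocks are controlled by `tailSeq`. -/
lemma normBound_shift_blockSeq_pow_sub (hφ : IsGrowth φ) {b s ε : ℝ}
    (hF : ∀ n ∈ F, ∀ n' ∈ F, n < n' → n + N ≤ n')
    (hμ : ∀ n ∈ F, 0 ≤ μ n ∧ μ n ≤ b) (hs0 : 0 ≤ s) (hsb : s ≤ b) (hq : 1 ≤ q) (v : X)
    (hv : ∀ k, N ≤ k → coord v k = 0) (hr : ∀ l, r l ^ q = coord v l) {n : ℕ} (hn : n ∈ F)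
    (hns : |Real.exp ((s - μ n) * φ n) - 1| ≤ ε)
    (htail : NormBound X (fun k => (tailSeq φ F μ s n k : ℂ)) ε) :
    NormBound X (fun k => (Real.exp (s * (φ (n + k) - φ k)) : ℂ)
      * blockSeq φ F N μ r q (n + k) ^ q - coord v k)
      (ε * ((1 + N * Real.exp (2 * b * N)) * ‖v‖)) := by
  have hε : 0 ≤ ε := (abs_nonneg _).trans hns
  have hqne : (q : ℝ) ≠ 0 := by exact_mod_cast (by omega : q ≠ 0)
  have hblock : ∀ m ∈ F, ∀ l < N, blockSeq φ F N μ r q (m + l) ^ q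
      = coord v l * (Real.exp (-(μ m * (φ (m + l) - φ l))) : ℂ) := fun m hm l hl => by
    rw [blockSeq_apply hF hm hl, mul_pow, hr, ← Complex.ofReal_pow, ← Real.exp_nat_mul]
    congr 4
    field_simp
  set C : ℝ := ‖v‖ * Real.exp (2 * b * N) with hC
  have hC0 : 0 ≤ C := by positivity
  have h1 : NormBound X (fun k => ((ε * ‖coord v k‖ : ℝ) : ℂ)) (ε * ‖v‖) := by
    refine ((normBound_coord v).smul (ε : ℂ)).mono (fun k => ?_) ?_
    · rw [Complex.norm_real, Pi.smul_apply, norm_smul, Complex.norm_real, norm_mul, norm_norm]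
    · rw [Complex.norm_real, Real.norm_of_nonneg hε]
  have h2 : NormBound X (∑ l ∈ Finset.range N, fun k =>
      if l ≤ k then (tailSeq φ F μ s n (k - l) : ℂ) else 0) (∑ l ∈ Finset.range N, ε) :=
    NormBound.sum _ fun l _ => htail.shift l
  refine (h1.add (h2.smul (C : ℂ))).mono (fun k => ?_) ?_
  swap
  · rw [Complex.norm_real, Real.norm_of_nonneg hC0, Finset.sum_const, Finset.card_range,
      nsmul_eq_mul, hC]
    exact le_of_eq (by ring)
  have hsum : (∑ l ∈ Finset.range N, fun k =>
      if l ≤ k then (tailSeq φ F μ s n (k - l) : ℂ) else 0) k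
      = ((∑ l ∈ Finset.range N, if l ≤ k then tailSeq φ F μ s n (k - l) else 0 : ℝ) : ℂ) := by
    rw [Finset.sum_apply, Complex.ofReal_sum]
    refine Finset.sum_congr rfl fun l _ => ?_
    split_ifs
    · rfl
    · exact Complex.ofReal_zero.symm
  have hpos : ∀ l ∈ Finset.range N,
      0 ≤ (if l ≤ k then tailSeq φ F μ s n (k - l) else 0 : ℝ) := fun l _ => by
    split_ifs
    · exact tailSeq_nonneg ..
    · exact le_rfl
  have hS := Finset.sum_nonneg hpos
  rw [Pi.add_apply, Pi.smul_apply, hsum, smul_eq_mul, ← Complex.ofReal_mul, ← Complex.ofReal_add,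
    Complex.norm_real, Real.norm_of_nonneg (by positivity)]
  rcases lt_or_ge k N with hk | hk
  · rw [hblock n hn k hk]
    have e1 : (Real.exp (s * (φ (n + k) - φ k)) : ℂ)
        * (coord v k * (Real.exp (-(μ n * (φ (n + k) - φ k))) : ℂ)) - coord v k
        = ((Real.exp ((s - μ n) * (φ (n + k) - φ k)) - 1 : ℝ) : ℂ) * coord v k := by
      have : Real.exp ((s - μ n) * (φ (n + k) - φ k)) = Real.exp (s * (φ (n + k) - φ k))
          * Real.exp (-(μ n * (φ (n + k) - φ k))) := by
        rw [← Real.exp_add]; ring_nf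
      rw [this]
      push_cast
      ring
    rw [e1, norm_mul, Complex.norm_real, Real.norm_eq_abs]
    have e2 := abs_exp_sub_one_le_of_between (t := s - μ n)
      (sub_nonneg.2 (hφ.mono (Nat.le_add_left k n))) (sub_le_iff_le_add.2 (hφ.add_le n k))
    calc _ ≤ ε * ‖coord v k‖ := by gcongr; exact e2.trans hns
      _ ≤ _ := le_add_of_nonneg_right (by positivity)
  · rw [hv k hk, sub_zero]
    by_cases hz : blockSeq φ F N μ r q (n + k) = 0
    · rw [hz, zero_pow (by omega), mul_zero, norm_zero]
      positivity
    obtain ⟨j, hj, l, hl, hjl⟩ := exists_of_blockSeq_ne_zero hz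
    have hnj : n < j := by
      rcases lt_trichotomy n j with h | h | h
      · exact h
      · omega
      · have := hF j hj n hn h
        omega
    obtain ⟨k', hk', rfl⟩ : ∃ k', k' ≠ 0 ∧ k = k' + l := ⟨j - n, by omega, by omega⟩
    obtain rfl : j = n + k' := by omega
    rw [hjl, hblock _ hj l hl, norm_mul, norm_mul, Complex.norm_real, Complex.norm_real,
      Real.norm_of_nonneg (Real.exp_pos _).le, Real.norm_of_nonneg (Real.exp_pos _).le]
    have e1 : tailSeq φ F μ s n k' ≤
        ∑ i ∈ Finset.range N, if i ≤ k' + l then tailSeq φ F μ s n (k' + l - i) else 0 := by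
      refine le_trans ?_ (Finset.single_le_sum hpos (Finset.mem_range.2 hl))
      rw [if_pos (Nat.le_add_left l k'), Nat.add_sub_cancel]
    have e2 : tailSeq φ F μ s n k'
        = Real.exp (s * (φ (n + k') - φ k') - μ (n + k') * φ (n + k')) := if_pos ⟨hk', hj⟩
    obtain ⟨m0, mb⟩ := hμ _ hj
    have e3 : Real.exp (s * (φ (n + k' + l) - φ (k' + l)))
        * Real.exp (-(μ (n + k') * (φ (n + k' + l) - φ l)))
        ≤ Real.exp (2 * b * N) * tailSeq φ F μ s n k' := by
      rw [e2, ← Real.exp_add, ← Real.exp_add]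
      refine Real.exp_le_exp.2 ?_
      have f1 := mul_le_mul_of_nonneg_left (hφ.add_le (n + k') l) hs0
      have f2 := mul_le_mul_of_nonneg_left (hφ.mono (Nat.le_add_right k' l)) hs0
      have f3 := mul_le_mul_of_nonneg_left (hφ.mono (Nat.le_add_right (n + k') l)) m0
      have f4 : φ l ≤ N := hφ.le_of_le hl.le
      have f5 : s * φ l ≤ b * N := mul_le_mul hsb f4 (hφ.nonneg l) (hs0.trans hsb)
      have f6 : μ (n + k') * φ l ≤ b * N := mul_le_mul mb f4 (hφ.nonneg l) (hs0.trans hsb)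
      linarith
    calc _ = ‖coord v l‖ * (Real.exp (s * (φ (n + k' + l) - φ (k' + l)))
        * Real.exp (-(μ (n + k') * (φ (n + k' + l) - φ l)))) := by ring
      _ ≤ ‖v‖ * (Real.exp (2 * b * N) * tailSeq φ F μ s n k') := by
        gcongr
        exact norm_coord_le v l
      _ = C * tailSeq φ F μ s n k' := by rw [hC]; ring
      _ ≤ _ := by
        refine le_trans (mul_le_mul_of_nonneg_left e1 hC0) ?_
        exact le_add_of_nonneg_left (by positivity)

end Block

/-! ### Density -/

section Density

variable {X : Type*} [NonUnitalNormedRing X] [NormedSpace ℂ X] [SequenceAlgebra X]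

/-- For small `z` vanishing before the time `n`, the terms of degree `> m + 1` of `lowPoly m c` are
dominated, coordinate by coordinate, by a small multiple of the term of degree `m + 1`. By solidity
they do not matter. -/
lemma norm_iterate_lowPoly_sub_le {φ : ℕ → ℝ} {T : ℝ → X →L[ℂ] X} (hT : IsShiftFamily φ T)
    {s : ℝ} {n N : ℕ} (hNn : N ≤ n) {u z v : X} (hu : ∀ k, N ≤ k → coord u k = 0) {m D : ℕ}
    {c : Fin D → ℂ} {R κ e : ℝ} (hc : ‖c‖ ≤ R) (hz : ‖z‖ ≤ κ) (hκ : κ ≤ 1)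
    (he : NormBound X (fun k => (Real.exp (s * (φ (n + k) - φ k)) : ℂ)
      * coord z (n + k) ^ (m + 1) - coord v k) e) :
    ‖(T s)^[n] (lowPoly m c (u + z)) - v‖ ≤ e + D * R * κ * (‖v‖ + e) := by
  have hR : 0 ≤ R := (norm_nonneg _).trans hc
  have hκ0 : 0 ≤ κ := (norm_nonneg _).trans hz
  set S : ℕ → ℂ := fun k => (Real.exp (s * (φ (n + k) - φ k)) : ℂ) * coord z (n + k) ^ (m + 1)
    with hS
  have hS' : NormBound X S (‖v‖ + e) := by
    have := (normBound_coord v).add he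
    rwa [show coord v + (fun k => (Real.exp (s * (φ (n + k) - φ k)) : ℂ)
      * coord z (n + k) ^ (m + 1) - coord v k) = S from funext fun k => by simp [hS]] at this
  have hrest := hS'.smul ((D * R * κ : ℝ) : ℂ)
  rw [Complex.norm_real, Real.norm_of_nonneg (by positivity)] at hrest
  have hrest' : NormBound X (fun k => S k * ∑ j : Fin D, c j * coord z (n + k) ^ ((j : ℕ) + 1))
      (D * R * κ * (‖v‖ + e)) := by
    refine hrest.mono (fun k => ?_) le_rfl
    rw [Pi.smul_apply, norm_mul, norm_smul, mul_comm, Complex.norm_real,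
      Real.norm_of_nonneg (by positivity)]
    gcongr
    have ht : ‖coord z (n + k)‖ ≤ κ := (norm_coord_le z _).trans hz
    calc ‖∑ j : Fin D, c j * coord z (n + k) ^ ((j : ℕ) + 1)‖
        ≤ ∑ _j : Fin D, R * κ := by
          refine norm_sum_le_of_le _ fun j _ => ?_
          rw [norm_mul, norm_pow]
          gcongr
          · exact (norm_le_pi_norm c j).trans hc
          · exact (pow_le_of_le_one (norm_nonneg _) (ht.trans hκ) (by omega)).trans ht
      _ = D * R * κ := by simp [mul_assoc]
  refine NormBound.norm_le (X := X) ?_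
  have hsum := he.add hrest'
  convert hsum using 1
  funext k
  rw [map_sub, Pi.sub_apply, hT.coord_iterate, coord_lowPoly, map_add, Pi.add_apply, Pi.add_apply,
    hu (n + k) (by omega), zero_add]
  simp only [hS]
  ring

lemma exists_bounds_of_isCompact {d : ℕ} {K : Set (Fin d → ℝ)} (hK : IsCompact K)
    (hpos : ∀ s ∈ K, ∀ i, 0 < s i) : ∃ a b : ℝ, 0 < a ∧ 0 ≤ b ∧ ∀ s ∈ K, ∀ i, a ≤ s i ∧ s i ≤ b := by
  obtain ⟨b, hb⟩ := hK.exists_bound_of_continuousOn (f := fun s : Fin d → ℝ => s) continuousOn_id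
  obtain ⟨c, hc⟩ := hK.exists_bound_of_continuousOn (f := fun (s : Fin d → ℝ) i => (s i)⁻¹)
    (continuousOn_pi.2 fun i => (continuous_apply i).continuousOn.inv₀ fun s hs => (hpos s hs i).ne')
  refine ⟨(|c| + 1)⁻¹, |b|, by positivity, abs_nonneg _, fun s hs i => ⟨?_, ?_⟩⟩
  · have h1 := (norm_le_pi_norm (fun i => (s i)⁻¹) i).trans (hc s hs)
    have h2 : (s i)⁻¹ ≤ |c| + 1 := by
      have := le_abs_self ((s i)⁻¹)
      rw [Real.norm_eq_abs] at h1
      linarith [le_abs_self c]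
    exact inv_le_of_inv_le₀ (hpos s hs i) h2
  · exact (le_abs_self _).trans ((norm_le_pi_norm s i).trans ((hb s hs).trans (le_abs_self b)))

/-- Near any `u` there are vectors `u'` such that, for every `s ∈ K` and every coefficient vector
bounded by `R`, the orbit of the polynomial evaluated at `u'` comes close to `v`. -/
theorem exists_near_of_coverable {φ : ℕ → ℝ} (hφ : IsGrowth φ) {T : ℝ → X →L[ℂ] X}
    (hT : IsShiftFamily φ T) {d : ℕ} {K : Set (Fin d → ℝ)} (hK : IsCompact K)
    (hpos : ∀ s ∈ K, ∀ i, 0 < s i) (hcov : Coverable X φ K) (u v : Fin d → X)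
    (hu : ∀ i, ∃ N, ∀ k, N ≤ k → coord (u i) k = 0)
    (hv : ∀ i, ∃ N, ∀ k, N ≤ k → coord (v i) k = 0) (m D : ℕ) {R η : ℝ} (hR : 0 ≤ R)
    (hη : 0 < η) :
    ∃ u' : Fin d → X, ‖u' - u‖ < η ∧ ∀ s ∈ K, ∀ c : Fin D → ℂ, ‖c‖ ≤ R →
      ∃ n, 1 ≤ n ∧ ‖(fun i => (T (s i))^[n] (lowPoly m c (u' i))) - v‖ < η := by
  obtain ⟨a, b, ha, hb, hab⟩ := exists_bounds_of_isCompact hK hpos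
  obtain ⟨N, hN1, hNu, hNv⟩ : ∃ N, 1 ≤ N ∧ (∀ i k, N ≤ k → coord (u i) k = 0) ∧
      ∀ i k, N ≤ k → coord (v i) k = 0 := by
    choose Nu hNu using hu
    choose Nv hNv using hv
    refine ⟨1 + ∑ i, (Nu i + Nv i), by omega, fun i k hk => hNu i k ?_, fun i k hk => hNv i k ?_⟩ <;>
    · have := Finset.single_le_sum (f := fun i => Nu i + Nv i) (fun _ _ => Nat.zero_le _)
        (Finset.mem_univ i)
      omega
  have hroot : ∀ i l, ∃ r : ℂ, r ^ (m + 1) = coord (v i) l := fun i l =>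
    IsAlgClosed.exists_pow_nat_eq _ m.succ_pos
  choose r hr using hroot
  have hrρ : ∀ i l, ‖r i l‖ ≤ 1 + ‖v‖ := fun i l => by
    by_contra! h
    have h1 : 1 ≤ ‖r i l‖ := by linarith [norm_nonneg v]
    have h2 := le_self_pow₀ h1 m.succ_ne_zero
    rw [← norm_pow, hr] at h2
    linarith [(norm_coord_le (v i) l).trans (norm_le_pi_norm v i)]
  set M : ℝ := (1 + N * Real.exp (2 * b * N)) * ‖v‖ with hM
  have hM0 : 0 ≤ M := by positivity
  set ε : ℝ := η / (4 * (M + 1)) with hε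
  have hε0 : 0 < ε := by positivity
  have hεM : ε * M ≤ η / 4 := by
    rw [hε, div_mul_eq_mul_div, div_le_div_iff₀ (by positivity) (by norm_num)]
    nlinarith
  -- `κ` bounds the perturbation `z`, and is small enough to make the higher powers negligible.
  set κ : ℝ := min 1 (min (η / 2) (η / (4 * (D * R * (‖v‖ + η) + 1)))) with hκ
  have hκ0 : 0 < κ := by positivity
  have hκ1 : κ ≤ 1 := min_le_left _ _
  have hκ2 : κ ≤ η / 2 := (min_le_right _ _).trans (min_le_left _ _)
  have hκ3 : D * R * κ * (‖v‖ + η) ≤ η / 4 := by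
    have h := (min_le_right _ _).trans (min_le_right _ _) |>.trans_eq' hκ
    have h0 : 0 ≤ D * R * (‖v‖ + η) := by positivity
    rw [le_div_iff₀ (by positivity)] at h
    nlinarith
  set C : ℝ := N * (1 + ‖v‖) * Real.exp (b * N) with hC
  have hC0 : 0 ≤ C := by positivity
  -- Late blocks are small in norm, because `∑ exp (-(a / (m + 1)) φ(n))` converges.
  obtain ⟨s₀, hs₀⟩ := summable_iff_vanishing_norm.1
    (hφ.summable (a / (m + 1 : ℕ)) (by positivity)) (κ / (C + 1)) (by positivity)
  obtain ⟨F, μ, hF0, hFK, hFN, hFcov⟩ := hcov N (N + (s₀.sup id + 1)) ε hN1 hε0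
  have hdisj : Disjoint F s₀ := Finset.disjoint_left.2 fun n hn hn' => by
    have h1 := hF0 n hn
    have h2 : n ≤ s₀.sup id := Finset.le_sup (f := id) hn'
    omega
  have hsmall := (le_abs_self _).trans_lt (hs₀ F hdisj)
  have hz : ∀ i, ∃ z : X, coord z = blockSeq φ F N (fun n => μ n i) (r i) (m + 1) ∧ ‖z‖ ≤ κ :=
    fun i => by
    obtain ⟨z, hz, hzn⟩ := normBound_blockSeq (X := X) (N := N) (μ := fun n => μ n i) (r := r i)
      (q := m + 1) hφ ha.le (fun n hn => hab _ (hFK n hn) i) (by positivity)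
      (fun l _ => hrρ i l) (by omega)
    refine ⟨z, hz, hzn.trans ?_⟩
    calc _ ≤ C * (κ / (C + 1)) := by gcongr
      _ ≤ κ := by
        rw [mul_div_assoc', div_le_iff₀ (by positivity)]
        nlinarith
  choose z hz hzκ using hz
  refine ⟨u + z, ?_, fun s hs c hc => ?_⟩
  · rw [add_sub_cancel_left]
    exact ((pi_norm_le_iff_of_nonneg hκ0.le).2 hzκ).trans_lt (by linarith)
  · obtain ⟨n, hn, hcn⟩ := hFcov s hs
    have hNn := hF0 n hn
    refine ⟨n, by omega, (pi_norm_lt_iff hη).2 fun i => ?_⟩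
    have he := normBound_shift_blockSeq_pow_sub (μ := fun n => μ n i) (b := b) hφ hFN
      (fun n hn => ⟨ha.le.trans (hab _ (hFK n hn) i).1, (hab _ (hFK n hn) i).2⟩)
      (ha.le.trans (hab s hs i).1) (hab s hs i).2 (q := m + 1) (by omega) (v i) (hNv i) (hr i) hn
      (hcn i).1 (hcn i).2
    rw [← hz i] at he
    have hvi := norm_le_pi_norm v i
    have he' := he.mono (fun _ => le_rfl) (c' := η / 4) <| le_trans (by rw [hM]; gcongr) hεM
    refine (norm_iterate_lowPoly_sub_le hT (by omega) (hNu i) hc (hzκ i) hκ1 he').trans_lt ?_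
    have : D * R * κ * (‖v i‖ + η / 4) ≤ D * R * κ * (‖v‖ + η) := by
      gcongr
      linarith
    linarith

end Density

/-! ### Baire category and the generated algebra -/

section Baire

variable {X : Type*} [NonUnitalNormedRing X] [NormedSpace ℂ X] [SequenceAlgebra X]

lemma dense_finite_support_pi (d : ℕ) :
    Dense {u : Fin d → X | ∀ i, ∃ N, ∀ k, N ≤ k → coord (u i) k = 0} := by
  have := dense_pi (Set.univ : Set (Fin d)) fun i _ => dense_finite_support (X := X)
  simpa [Set.pi] using this

lemma isOpen_forall_exists_iterate_mem {φ : ℕ → ℝ} (hφ : IsGrowth φ) {T : ℝ → X →L[ℂ] X}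
    (hT : IsShiftFamily φ T) {d : ℕ} {K : Set (Fin d → ℝ)} (hK : IsCompact K) (m D : ℕ) (R : ℝ)
    {V : Set (Fin d → X)} (hV : IsOpen V) :
    IsOpen {u : Fin d → X | ∀ s ∈ K, ∀ c : Fin D → ℂ, ‖c‖ ≤ R →
      ∃ n, 1 ≤ n ∧ (fun i => (T (s i))^[n] (lowPoly m c (u i))) ∈ V} := by
  refine isOpen_iff_mem_nhds.2 fun u hu => ?_
  have hcomp : IsCompact (K ×ˢ Metric.closedBall (0 : Fin D → ℂ) R) :=
    hK.prod (isCompact_closedBall _ _)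
  have := hcomp.eventually_forall_of_forall_eventually (x₀ := u)
    (P := fun u q => ∃ n, 1 ≤ n ∧ (fun i => (T (q.1 i))^[n] (lowPoly m q.2 (u i))) ∈ V)
    fun q hq => by
      obtain ⟨n, hn, h⟩ := hu q.1 hq.1 q.2 (mem_closedBall_zero_iff.1 hq.2)
      have hcont : Continuous fun w : (Fin d → X) × ((Fin d → ℝ) × (Fin D → ℂ)) =>
          fun i => (T (w.2.1 i))^[n] (lowPoly m w.2.2 (w.1 i)) := by
        refine continuous_pi fun i => (hT.continuous_iterate hφ n).comp
          (Continuous.prodMk (by fun_prop) ((continuous_lowPoly m D).comp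
            (Continuous.prodMk (by fun_prop) (by fun_prop))))
      filter_upwards [hcont.continuousAt.preimage_mem_nhds (hV.mem_nhds h)] with w hw
      exact ⟨n, hn, hw⟩
  filter_upwards [this] with u' hu' s hs c hc
  exact hu' (s, c) ⟨hs, mem_closedBall_zero_iff.2 hc⟩

lemma dense_forall_exists_iterate_mem {φ : ℕ → ℝ} (hφ : IsGrowth φ) {T : ℝ → X →L[ℂ] X}
    (hT : IsShiftFamily φ T) {d : ℕ} {K : Set (Fin d → ℝ)} (hK : IsCompact K)
    (hpos : ∀ s ∈ K, ∀ i, 0 < s i) (hcov : Coverable X φ K) (m D : ℕ) {R : ℝ} (hR : 0 ≤ R)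
    {V : Set (Fin d → X)} (hV : IsOpen V) (hVne : V.Nonempty) :
    Dense {u : Fin d → X | ∀ s ∈ K, ∀ c : Fin D → ℂ, ‖c‖ ≤ R →
      ∃ n, 1 ≤ n ∧ (fun i => (T (s i))^[n] (lowPoly m c (u i))) ∈ V} := by
  refine dense_iff_inter_open.2 fun U hU hUne => ?_
  obtain ⟨u, hu, huU⟩ := (dense_finite_support_pi (X := X) d).exists_mem_open hU hUne
  obtain ⟨v, hv, hvV⟩ := (dense_finite_support_pi (X := X) d).exists_mem_open hV hVne
  obtain ⟨η₁, h1, hU1⟩ := Metric.isOpen_iff.1 hU u huU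
  obtain ⟨η₂, h2, hV2⟩ := Metric.isOpen_iff.1 hV v hvV
  obtain ⟨u', hu', h⟩ := exists_near_of_coverable hφ hT hK hpos hcov u v hu hv m D hR
    (lt_min h1 h2)
  refine ⟨u', hU1 ?_, fun s hs c hc => ?_⟩
  · rw [Metric.mem_ball, dist_eq_norm]
    exact hu'.trans_le (min_le_left _ _)
  · obtain ⟨n, hn, hlt⟩ := h s hs c hc
    refine ⟨n, hn, hV2 ?_⟩
    rw [Metric.mem_ball, dist_eq_norm]
    exact hlt.trans_le (min_le_right _ _)

/-- The elements `P(u)` of `X ^ d`, where `P` is a polynomial without constant term, written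
`P(t) = t * Q(t)`. -/
def polynomialAlgebra {d : ℕ} (u : Fin d → X) : NonUnitalSubalgebra ℂ (Fin d → X) where
  carrier := {y | ∃ Q : Polynomial ℂ, ∀ i k,
    coord (y i) k = coord (u i) k * Q.eval (coord (u i) k)}
  zero_mem' := ⟨0, fun i k => by simp⟩
  add_mem' := by
    rintro y y' ⟨Q, hQ⟩ ⟨Q', hQ'⟩
    exact ⟨Q + Q', fun i k => by simp [hQ, hQ', mul_add]⟩
  mul_mem' := by
    rintro y y' ⟨Q, hQ⟩ ⟨Q', hQ'⟩
    refine ⟨Polynomial.X * Q * Q', fun i k => ?_⟩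
    rw [Pi.mul_apply, coord_mul, hQ, hQ', Polynomial.eval_mul, Polynomial.eval_mul,
      Polynomial.eval_X]
    ring
  smul_mem' := by
    rintro c y ⟨Q, hQ⟩
    refine ⟨Polynomial.C c * Q, fun i k => ?_⟩
    rw [Pi.smul_apply, map_smul, Pi.smul_apply, hQ, Polynomial.eval_mul, Polynomial.eval_C,
      smul_eq_mul]
    ring

lemma exists_eq_smul_lowPoly {d : ℕ} {u y : Fin d → X} (hy : y ∈ polynomialAlgebra u)
    (h0 : y ≠ 0) : ∃ (a : ℂ) (m D : ℕ) (c : Fin D → ℂ), a ≠ 0 ∧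
      y = a • fun i => lowPoly m c (u i) := by
  obtain ⟨P, hP⟩ := hy
  have hP0 : P ≠ 0 := by
    rintro rfl
    exact h0 (funext fun i => coord_injective (funext fun k => by simp [hP]))
  obtain ⟨Q, hQ, hdvd⟩ := Polynomial.exists_eq_pow_rootMultiplicity_mul_and_not_dvd P hP0 0
  rw [Polynomial.C_0, sub_zero] at hQ hdvd
  have ha : Q.coeff 0 ≠ 0 := fun h => hdvd (Polynomial.X_dvd_iff.2 h)
  refine ⟨Q.coeff 0, P.rootMultiplicity 0, Q.natDegree,
    fun j => Q.coeff (j + 1) / Q.coeff 0, ha,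
    funext fun i => coord_injective (funext fun k => ?_)⟩
  rw [hP, Pi.smul_apply, map_smul, Pi.smul_apply, coord_lowPoly, smul_eq_mul]
  set t := coord (u i) k
  have hev : Q.eval t = Q.coeff 0
      * (1 + ∑ j : Fin Q.natDegree, Q.coeff (j + 1) / Q.coeff 0 * t ^ ((j : ℕ) + 1)) := by
    rw [Polynomial.eval_eq_sum_range, Finset.sum_range_succ', Finset.sum_range, mul_add,
      Finset.mul_sum, add_comm, pow_zero]
    congr 1
    refine Finset.sum_congr rfl fun j _ => ?_
    field_simp
  conv_lhs => rw [hQ]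
  rw [Polynomial.eval_mul, Polynomial.eval_pow, Polynomial.eval_X, hev]
  ring

theorem hasCommonHypercyclicAlgebra_of_coverable [CompleteSpace X] {φ : ℕ → ℝ} (hφ : IsGrowth φ)
    {T : ℝ → X →L[ℂ] X} (hT : IsShiftFamily φ T) {d : ℕ} (hd : 1 ≤ d) {ι : Type*} [Countable ι]
    (K : ι → Set (Fin d → ℝ)) (hK : ∀ j, IsCompact (K j)) (hpos : ∀ j, ∀ s ∈ K j, ∀ i, 0 < s i)
    (hcov : ∀ j, Coverable X φ (K j)) :
    HasCommonHypercyclicAlgebra (X := Fin d → X) (⋃ j, K j)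
      (fun l => prodOperator fun i => T (l i)) := by
  have : TopologicalSpace.SeparableSpace X := separableSpace X
  have : SecondCountableTopology X := UniformSpace.secondCountable_of_separable X
  have : Nontrivial X := nontrivial
  have : Nonempty (Fin d) := ⟨⟨0, hd⟩⟩
  let B := TopologicalSpace.countableBasis (Fin d → X)
  let G : ι × B × ℕ × ℕ × ℕ → Set (Fin d → X) := fun q =>
    {u | ∀ s ∈ K q.1, ∀ c : Fin q.2.2.2.1 → ℂ, ‖c‖ ≤ (q.2.2.2.2 : ℝ) →
      ∃ n, 1 ≤ n ∧ (fun i => (T (s i))^[n] (lowPoly q.2.2.1 c (u i))) ∈ (q.2.1 : Set (Fin d → X))}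
  have : Countable B := (TopologicalSpace.countable_countableBasis _).to_subtype
  have hdense : Dense (⋂ q, G q) := dense_iInter_of_isOpen
    (fun q => isOpen_forall_exists_iterate_mem hφ hT (hK q.1) _ _ _
      (TopologicalSpace.isOpen_of_mem_countableBasis q.2.1.2))
    (fun q => dense_forall_exists_iterate_mem hφ hT (hK q.1) (hpos q.1) (hcov q.1) _ _
      (Nat.cast_nonneg _) (TopologicalSpace.isOpen_of_mem_countableBasis q.2.1.2)
      (TopologicalSpace.nonempty_of_mem_countableBasis q.2.1.2))
  obtain ⟨u, hu, hu0⟩ := hdense.exists_mem_open (isOpen_compl_singleton (x := (0 : Fin d → X)))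
    (exists_ne 0)
  rw [Set.mem_iInter] at hu
  refine ⟨polynomialAlgebra u, ⟨u, ⟨1, fun i k => by simp⟩, hu0⟩, fun y hy hy0 s hs => ?_⟩
  obtain ⟨a, m, D, c, ha, rfl⟩ := exists_eq_smul_lowPoly hy hy0
  obtain ⟨j, hj⟩ := Set.mem_iUnion.1 hs
  refine dense_iff_inter_open.2 fun U hU ⟨x, hx⟩ => ?_
  have hU' : IsOpen {z : Fin d → X | a • z ∈ U} := hU.preimage (continuous_const_smul a)
  have hx' : a⁻¹ • x ∈ {z : Fin d → X | a • z ∈ U} := by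
    change a • a⁻¹ • x ∈ U
    rwa [smul_inv_smul₀ ha]
  obtain ⟨V, hVB, -, hVU⟩ :=
    (TopologicalSpace.isBasis_countableBasis (Fin d → X)).exists_subset_of_mem_open hx' hU'
  obtain ⟨R, hR⟩ := exists_nat_ge ‖c‖
  obtain ⟨n, hn, hnV⟩ := hu (j, ⟨V, hVB⟩, m, D, R) s hj c hR
  refine ⟨_, ?_, n, hn, rfl⟩
  have h : (a • fun i => (T (s i))^[n] (lowPoly m c (u i))) ∈ U := hVU hnV
  convert h using 1
  funext i
  rw [prodOperator_iterate]
  exact Function.Commute.iterate_left (f := T (s i)) (g := fun z => a • z)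
    (fun z => map_smul (T (s i)) a z) n _

end Baire

/-! ### Consequences of a common hypercyclic vector -/

section Necessity

variable {X : Type*} [NonUnitalNormedRing X] [NormedSpace ℂ X] [SequenceAlgebra X]

/-- Every vector is approached at arbitrarily late times, as the space has no isolated points. -/
lemma IsHypercyclicVector.exists_late {d : ℕ} (hd : 1 ≤ d)
    {S : (Fin d → X) →L[ℂ] (Fin d → X)} {x : Fin d → X} (hx : IsHypercyclicVector S x)
    (y : Fin d → X) {δ : ℝ} (hδ : 0 < δ) (n₀ : ℕ) : ∃ n, n₀ ≤ n ∧ ‖(⇑S)^[n] x - y‖ < δ := by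
  have : Nontrivial X := nontrivial
  have : Nonempty (Fin d) := ⟨⟨0, hd⟩⟩
  have hne : ∀ z : Fin d → X, (nhdsWithin z {z}ᶜ).NeBot :=
    fun z => Module.punctured_nhds_neBot ℂ _ z
  have hfin : ((fun n => (⇑S)^[n] x) '' Set.Iio n₀).Finite := (Set.finite_Iio n₀).image _
  obtain ⟨z, ⟨⟨n, -, rfl⟩, hz⟩, hzy⟩ :=
    (hx.sdiff_finite hfin).exists_mem_open Metric.isOpen_ball ⟨y, Metric.mem_ball_self hδ⟩
  refine ⟨n, ?_, by rwa [Metric.mem_ball, dist_eq_norm] at hzy⟩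
  by_contra! h
  exact hz ⟨n, h, rfl⟩

lemma pos_of_isHypercyclicVector {φ : ℕ → ℝ} (hφ : IsGrowth φ) {T : ℝ → X →L[ℂ] X}
    (hT : IsShiftFamily φ T) {d : ℕ} (hd : 1 ≤ d) {s : Fin d → ℝ} {x : Fin d → X}
    (hx : IsHypercyclicVector (prodOperator fun i => T (s i)) x) (i : Fin d) : 0 < s i := by
  by_contra! hs
  obtain ⟨e, he, -⟩ := exists_coord_eq_single (X := X) 0
  obtain ⟨n, -, hn⟩ := hx.exists_late hd (fun _ => ((‖x‖ + 1 : ℝ) : ℂ) • e) one_pos 0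
  have h1 := (norm_coord_le _ 0).trans_lt ((norm_le_pi_norm _ i).trans_lt hn)
  rw [Pi.sub_apply, prodOperator_iterate, map_sub, Pi.sub_apply, hT.coord_iterate, map_smul, he,
    hφ.zero, sub_zero, add_zero, Pi.smul_apply, Pi.single_eq_same, smul_eq_mul, mul_one] at h1
  have h2 : ‖(Real.exp (s i * φ n) : ℂ) * coord (x i) n‖ ≤ ‖x‖ := by
    rw [norm_mul, Complex.norm_real, Real.norm_of_nonneg (Real.exp_pos _).le]
    have h3 : Real.exp (s i * φ n) ≤ 1 :=
      Real.exp_le_one_iff.2 (mul_nonpos_of_nonpos_of_nonneg hs (hφ.nonneg n))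
    exact (mul_le_of_le_one_left (norm_nonneg _) h3).trans
      ((norm_coord_le _ _).trans (norm_le_pi_norm x i))
  have h4 := norm_sub_norm_le ((‖x‖ + 1 : ℝ) : ℂ) ((Real.exp (s i * φ n) : ℂ) * coord (x i) n)
  rw [norm_sub_rev, Complex.norm_real, Real.norm_of_nonneg (by positivity)] at h4
  linarith

/-- An entry of modulus `g` that is made small by the shift of parameter `s`, and not small by the
shift of parameter `s'`, orders the two parameters, whatever its final positions within a bounded
range. -/
lemma lt_of_exp_mul_lt {s s' b L P p p' g δ : ℝ} (hs : 0 ≤ s) (hsb : s ≤ b) (hs' : 0 ≤ s')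
    (hP : 0 ≤ P) (hp : 0 ≤ p) (hpL : p ≤ L) (hp' : 0 ≤ p') (hg : 0 ≤ g)
    (hδ : δ * Real.exp (b * L) ≤ 1 / 2) (h : Real.exp (s * (P - p)) * g < δ)
    (h' : 1 / 2 < Real.exp (s' * (P - p')) * g) : s < s' := by
  by_contra! hle
  have h1 : Real.exp (s' * (P - p')) ≤ Real.exp (s * (P - p)) * Real.exp (b * L) := by
    rw [← Real.exp_add, Real.exp_le_exp]
    have e1 : s' * P ≤ s * P := by gcongr
    have e2 : s * p ≤ b * L := mul_le_mul hsb hpL hp (hs.trans hsb)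
    have e3 : 0 ≤ s' * p' := by positivity
    linarith
  have h2 : Real.exp (s' * (P - p')) * g ≤ δ * Real.exp (b * L) := by
    calc _ ≤ Real.exp (s * (P - p)) * Real.exp (b * L) * g := by gcongr
      _ = Real.exp (s * (P - p)) * g * Real.exp (b * L) := by ring
      _ ≤ _ := by gcongr
  linarith

/-- If at time `n` (for the parameter `s`) and at time `n' > n` (for `s'`) the sequence `ξ` is sent
close to `e_0 + 2 e_N`, then `n' > n + N`. Indeed a nonzero entry of the target at one of the two
times facing a zero entry at the other orders `s` and `s'`, and if `n' ≤ n + N` both orders would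
occur; for `n' = n + N` the second order comes from the entries `2` and `1` facing each other. -/
lemma add_lt_of_two_hits {φ : ℕ → ℝ} (hφ : IsGrowth φ) {s s' b δ : ℝ} {N n n' : ℕ} (hN : 1 ≤ N)
    (hs : 0 ≤ s) (hsb : s ≤ b) (hs' : 0 ≤ s') (hsb' : s' ≤ b) (hδ4 : δ ≤ 1 / 4)
    (hδ : δ * Real.exp (b * (2 * N)) ≤ 1 / 2) {ξ t : ℕ → ℂ} (ht0 : t 0 = 1) (htN : t N = 2)
    (ht : ∀ k, k ≠ 0 → k ≠ N → t k = 0)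
    (h : ∀ k, ‖(Real.exp (s * (φ (n + k) - φ k)) : ℂ) * ξ (n + k) - t k‖ < δ)
    (h' : ∀ k, ‖(Real.exp (s' * (φ (n' + k) - φ k)) : ℂ) * ξ (n' + k) - t k‖ < δ)
    (hlt : n < n') : n + N < n' := by
  have hnorm : ∀ (a : ℝ) (z : ℂ), ‖(Real.exp a : ℂ) * z‖ = Real.exp a * ‖z‖ := fun a z => by
    rw [norm_mul, Complex.norm_real, Real.norm_of_nonneg (Real.exp_pos _).le]
  have hz : ∀ {a : ℝ} {z w : ℂ}, ‖(Real.exp a : ℂ) * z - w‖ < δ → w = 0 →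
      Real.exp a * ‖z‖ < δ := fun {a z w} h hw => by rwa [hw, sub_zero, hnorm] at h
  have hlow : ∀ {a : ℝ} {z w : ℂ}, ‖(Real.exp a : ℂ) * z - w‖ < δ →
      ‖w‖ - δ < Real.exp a * ‖z‖ := fun {a z w} h => by
    have := norm_sub_norm_le w ((Real.exp a : ℂ) * z)
    rw [norm_sub_rev, hnorm] at this
    linarith
  have hup : ∀ {a : ℝ} {z w : ℂ}, ‖(Real.exp a : ℂ) * z - w‖ < δ →
      Real.exp a * ‖z‖ < ‖w‖ + δ := fun {a z w} h => by
    have := norm_sub_norm_le ((Real.exp a : ℂ) * z) w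
    rw [hnorm] at this
    linarith
  have hφL : ∀ {l : ℕ}, l ≤ 2 * N → φ l ≤ 2 * N := fun {l} hl => by
    have := hφ.le_of_le hl
    push_cast at this
    exact this
  by_contra! hle
  obtain ⟨l, rfl⟩ := Nat.exists_eq_add_of_le hlt.le
  have hn2 : ‖(2 : ℂ)‖ = 2 := by norm_num
  rcases eq_or_ne l N with rfl | hl
  · have h1 : s < s' := by
      have a1 := hz (h (2 * l)) (ht _ (by omega) (by omega))
      have a2 := hlow (h' l)
      rw [htN, hn2, show n + l + l = n + 2 * l by ring] at a2
      exact lt_of_exp_mul_lt hs hsb hs' (hφ.nonneg _) (hφ.nonneg _) (hφL le_rfl) (hφ.nonneg _)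
        (norm_nonneg _) hδ a1 ((by linarith : (1 : ℝ) / 2 ≤ 2 - δ).trans_lt a2)
    have a1 := hlow (h l)
    have a2 := hup (h' 0)
    rw [htN, hn2] at a1
    rw [ht0, norm_one, hφ.zero, sub_zero, add_zero] at a2
    have a3 : Real.exp (s * (φ (n + l) - φ l)) ≤ Real.exp (s' * φ (n + l)) := by
      refine Real.exp_le_exp.2 (mul_le_mul h1.le ?_ ?_ hs')
      · linarith [hφ.nonneg l]
      · exact sub_nonneg.2 (hφ.mono (Nat.le_add_left l n))
    have a4 := mul_le_mul_of_nonneg_right a3 (norm_nonneg (ξ (n + l)))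
    linarith
  · have h1 : s < s' := by
      have a1 := hz (h l) (ht _ (by omega) hl)
      have a2 := hlow (h' 0)
      rw [ht0, norm_one, add_zero] at a2
      exact lt_of_exp_mul_lt hs hsb hs' (hφ.nonneg _) (hφ.nonneg _) (hφL (by omega)) (hφ.nonneg _)
        (norm_nonneg _) hδ a1 ((by linarith : (1 : ℝ) / 2 ≤ 1 - δ).trans_lt a2)
    have h2 : s' < s := by
      have a1 := hz (h' (N - l)) (ht _ (by omega) (by omega))
      have a2 := hlow (h N)
      rw [show n + l + (N - l) = n + N by omega] at a1
      rw [htN, hn2] at a2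
      exact lt_of_exp_mul_lt hs' hsb' hs (hφ.nonneg _) (hφ.nonneg _) (hφL (by omega))
        (hφ.nonneg _) (norm_nonneg _) hδ a1 ((by linarith : (1 : ℝ) / 2 ≤ 2 - δ).trans_lt a2)
    exact lt_asymm h1 h2

lemma abs_exp_sub_one_le_of_two_hits {s s' y δ : ℝ} (hδ : δ ≤ 1 / 4) {z : ℂ}
    (h : ‖(Real.exp (s * y) : ℂ) * z - 1‖ < δ) (h' : ‖(Real.exp (s' * y) : ℂ) * z - 1‖ < δ) :
    |Real.exp ((s - s') * y) - 1| ≤ 4 * δ := by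
  set A := (Real.exp (s * y) : ℂ) * z
  set B := (Real.exp (s' * y) : ℂ) * z with hB
  have hAB : A - B = ((Real.exp ((s - s') * y) - 1 : ℝ) : ℂ) * B := by
    have : Real.exp (s * y) = Real.exp ((s - s') * y) * Real.exp (s' * y) := by
      rw [← Real.exp_add]; ring_nf
    simp only [A, B, this]
    push_cast
    ring
  have h1 : ‖A - B‖ < 2 * δ := by
    have := norm_sub_le (A - 1) (B - 1)
    rw [sub_sub_sub_cancel_right] at this
    linarith
  have h2 : 1 - ‖B‖ < δ := by
    have := norm_sub_norm_le (1 : ℂ) B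
    rw [norm_sub_rev, norm_one] at this
    linarith
  rw [hAB, norm_mul, Complex.norm_real, Real.norm_eq_abs] at h1
  nlinarith [abs_nonneg (Real.exp ((s - s') * y) - 1)]

/-- The boxes are centred at parameters whose orbits of `x` come close to the vector with entries
`e_0 + 2 e_N`, and the entries of `x` itself control the contribution of later times. -/
theorem coverable_of_isHypercyclicVector {φ : ℕ → ℝ} (hφ : IsGrowth φ) {T : ℝ → X →L[ℂ] X}
    (hT : IsShiftFamily φ T) {d : ℕ} (hd : 1 ≤ d) {K : Set (Fin d → ℝ)} (hK : IsCompact K)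
    {x : Fin d → X} (hx : ∀ s ∈ K, IsHypercyclicVector (prodOperator fun i => T (s i)) x) :
    Coverable X φ K := by
  classical
  intro N n₀ ε hN hε
  obtain ⟨a, b, ha, hb, hab⟩ := exists_bounds_of_isCompact hK
    fun s hs i => pos_of_isHypercyclicVector hφ hT hd (hx s hs) i
  -- The second bound on `δ` gives the precision `ε`, the third one the separation of the times.
  set δ : ℝ := min (1 / 4) (min (ε / 4) (Real.exp (-(b * (2 * N))) / 2)) with hδ
  have hδ0 : 0 < δ := by positivity
  have hδ4 : δ ≤ 1 / 4 := min_le_left _ _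
  have hδε : δ ≤ ε / 4 := (min_le_right _ _).trans (min_le_left _ _)
  have hδb : δ * Real.exp (b * (2 * N)) ≤ 1 / 2 := by
    have h := (min_le_right _ _).trans (min_le_right _ _) |>.trans_eq' hδ
    calc _ ≤ Real.exp (-(b * (2 * N))) / 2 * Real.exp (b * (2 * N)) := by gcongr
      _ = 1 / 2 := by rw [div_mul_eq_mul_div, ← Real.exp_add, neg_add_cancel, Real.exp_zero]
  obtain ⟨e₀, he₀, -⟩ := exists_coord_eq_single (X := X) 0
  obtain ⟨eN, heN, -⟩ := exists_coord_eq_single (X := X) N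
  set y : X := e₀ + (2 : ℂ) • eN with hy
  have hyk : ∀ k, coord y k = Pi.single (M := fun _ => ℂ) 0 1 k
      + 2 * Pi.single (M := fun _ => ℂ) N 1 k := fun k => by
    rw [hy, map_add, map_smul, he₀, heN]; rfl
  have hy0 : coord y 0 = 1 := by
    rw [hyk, Pi.single_eq_same, Pi.single_eq_of_ne (by omega), mul_zero, add_zero]
  have hyN : coord y N = 2 := by
    rw [hyk, Pi.single_eq_same, Pi.single_eq_of_ne (by omega), mul_one, zero_add]
  have hyz : ∀ k, k ≠ 0 → k ≠ N → coord y k = 0 := fun k h0 h1 => by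
    rw [hyk, Pi.single_eq_of_ne h0, Pi.single_eq_of_ne h1, mul_zero, add_zero]
  let O : ℕ → Set (Fin d → ℝ) := fun n =>
    {s | ‖(fun i => (T (s i))^[n] (x i)) - fun _ => y‖ < δ}
  have hO : ∀ n, IsOpen (O n) := fun n => by
    refine isOpen_lt (Continuous.norm (Continuous.sub (continuous_pi fun i => ?_)
      continuous_const)) continuous_const
    exact (hT.continuous_iterate hφ n).comp (Continuous.prodMk (continuous_apply i)
      continuous_const)
  have hOnorm : ∀ {n s}, s ∈ O n → ∀ i, ‖(T (s i))^[n] (x i) - y‖ < δ := fun {n s} hs i =>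
    (norm_le_pi_norm _ i).trans_lt hs
  have hOcoord : ∀ {n s}, s ∈ O n → ∀ i k,
      ‖(Real.exp (s i * (φ (n + k) - φ k)) : ℂ) * coord (x i) (n + k) - coord y k‖ < δ :=
    fun {n s} hs i k => by
      have := (norm_coord_le _ k).trans_lt (hOnorm hs i)
      rwa [map_sub, Pi.sub_apply, hT.coord_iterate] at this
  have hcover : K ⊆ ⋃ k, O (n₀ + k) := fun s hs => by
    obtain ⟨n, hn, h⟩ := (hx s hs).exists_late hd (fun _ => y) hδ0 n₀
    refine Set.mem_iUnion.2 ⟨n - n₀, ?_⟩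
    rw [Nat.add_sub_cancel' hn]
    change ‖_‖ < δ
    convert h using 3
    exact funext fun i => (prodOperator_iterate (fun i => T (s i)) n x i).symm
  obtain ⟨t, ht⟩ := hK.elim_finite_subcover _ (fun k => hO (n₀ + k)) hcover
  let F : Finset ℕ := (t.filter fun k => (O (n₀ + k) ∩ K).Nonempty).image fun k => n₀ + k
  have hF : ∀ n ∈ F, n₀ ≤ n ∧ (O n ∩ K).Nonempty := fun n hn => by
    obtain ⟨k, hk, rfl⟩ := Finset.mem_image.1 hn
    exact ⟨Nat.le_add_right _ _, (Finset.mem_filter.1 hk).2⟩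
  let μ : ℕ → Fin d → ℝ := fun n => if h : (O n ∩ K).Nonempty then h.some else 0
  have hμ : ∀ n ∈ F, μ n ∈ O n ∧ μ n ∈ K := fun n hn => by
    have h : (O n ∩ K).Nonempty := (hF n hn).2
    simp only [μ, dif_pos h]
    exact h.some_mem
  have hsep : ∀ n ∈ F, ∀ n' ∈ F, n < n' → n + N < n' := fun n hn n' hn' hlt => by
    obtain ⟨hO1, hK1⟩ := hμ n hn
    obtain ⟨hO2, hK2⟩ := hμ n' hn'
    let i : Fin d := ⟨0, hd⟩
    exact add_lt_of_two_hits hφ hN (ha.le.trans (hab _ hK1 i).1) (hab _ hK1 i).2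
      (ha.le.trans (hab _ hK2 i).1) (hab _ hK2 i).2 hδ4 hδb hy0 hyN hyz (hOcoord hO1 i)
      (hOcoord hO2 i) hlt
  refine ⟨F, μ, fun n hn => (hF n hn).1, fun n hn => (hμ n hn).2,
    fun n hn n' hn' hlt => (hsep n hn n' hn' hlt).le, fun s hs => ?_⟩
  obtain ⟨k, hk, hsk⟩ := Set.mem_iUnion₂.1 (ht hs)
  have hn : n₀ + k ∈ F := Finset.mem_image_of_mem _ (Finset.mem_filter.2 ⟨hk, s, hsk, hs⟩)
  set n := n₀ + k
  refine ⟨n, hn, fun i => ⟨?_, ?_⟩⟩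
  · have h1 := hOcoord hsk i 0
    have h2 := hOcoord (hμ n hn).1 i 0
    rw [hφ.zero, sub_zero, add_zero, hy0] at h1 h2
    exact (abs_exp_sub_one_le_of_two_hits hδ4 h1 h2).trans (by linarith)
  · refine ((normBound_coord ((T (s i))^[n] (x i) - y)).smul 2).mono (fun k => ?_) ?_
    · rw [Complex.norm_real, Real.norm_of_nonneg (tailSeq_nonneg ..), Pi.smul_apply, norm_smul]
      by_cases hk : k ≠ 0 ∧ n + k ∈ F
      · rw [tailSeq, if_pos hk]
        have hkN : N < k := by
          have := hsep n hn _ hk.2 (by omega)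
          omega
        rw [map_sub, Pi.sub_apply, hT.coord_iterate, hyz k hk.1 (by omega), sub_zero, norm_mul,
          Complex.norm_real, Real.norm_of_nonneg (Real.exp_pos _).le]
        have h1 := hOcoord (hμ _ hk.2).1 i 0
        rw [hφ.zero, sub_zero, add_zero, hy0] at h1
        have h2 := norm_sub_norm_le (1 : ℂ)
          ((Real.exp (μ (n + k) i * φ (n + k)) : ℂ) * coord (x i) (n + k))
        rw [norm_sub_rev, norm_one, norm_mul, Complex.norm_real,
          Real.norm_of_nonneg (Real.exp_pos _).le] at h2
        have h3 : Real.exp (-(μ (n + k) i * φ (n + k))) ≤ 2 * ‖coord (x i) (n + k)‖ := by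
          rw [Real.exp_neg, inv_le_iff_one_le_mul₀ (Real.exp_pos _)]
          linarith
        rw [sub_eq_add_neg, Real.exp_add]
        calc _ ≤ Real.exp (s i * (φ (n + k) - φ k)) * (2 * ‖coord (x i) (n + k)‖) := by gcongr
          _ = _ := by rw [Complex.norm_two]; ring
      · rw [tailSeq, if_neg hk]
        positivity
    · have := hOnorm hsk i
      rw [Complex.norm_two]
      linarith

/-- Every nonzero element of a common hypercyclic algebra is a common hypercyclic vector. -/
lemma HasCommonHypercyclicAlgebra.hasCommonHypercyclicVector {X : Type*} [TopologicalSpace X]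
    [NonUnitalRing X] [Module ℂ X] {ι : Type*} {S : Set ι} {T : ι → X →L[ℂ] X}
    (h : HasCommonHypercyclicAlgebra S T) : HasCommonHypercyclicVector S T := by
  obtain ⟨A, ⟨x, hx, hx0⟩, hA⟩ := h
  exact ⟨x, hA x hx hx0⟩

theorem hasCommonHypercyclicVector_iff_algebra [CompleteSpace X] {φ : ℕ → ℝ} (hφ : IsGrowth φ)
    {T : ℝ → X →L[ℂ] X} (hT : IsShiftFamily φ T) {d : ℕ} (hd : 1 ≤ d) {Λ : Set (Fin d → ℝ)}
    (hΛ : IsSigmaCompact Λ) :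
    HasCommonHypercyclicVector (X := Fin d → X) Λ (fun l => prodOperator fun i => T (l i)) ↔
      HasCommonHypercyclicAlgebra (X := Fin d → X) Λ (fun l => prodOperator fun i => T (l i)) := by
  refine ⟨fun ⟨x, hx⟩ => ?_, fun h => h.hasCommonHypercyclicVector⟩
  obtain ⟨K, hK, rfl⟩ := hΛ
  have hxK : ∀ j, ∀ s ∈ K j, IsHypercyclicVector (prodOperator fun i => T (s i)) x :=
    fun j s hs => hx s (Set.mem_iUnion.2 ⟨j, hs⟩)
  exact hasCommonHypercyclicAlgebra_of_coverable hφ hT hd K hK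
    (fun j s hs => pos_of_isHypercyclicVector hφ hT hd (hxK j s hs))
    (fun j => coverable_of_isHypercyclicVector hφ hT hd (hK j) (hxK j))

end Necessity

/-! ### Lipschitz curves -/

section Lipschitz

variable {X : Type*} [NonUnitalNormedRing X] [NormedSpace ℂ X] [SequenceAlgebra X]

/-- A sequence supported on the multiples `M, 2 M, …` with geometric decay of ratio `ρ ≤ 1 / 2` has
norm at most `2 ρ`. -/
lemma normBound_of_le_pow {ρ ε : ℝ} (hρ0 : 0 ≤ ρ) (hρ : ρ ≤ 1 / 2) (hρε : 2 * ρ ≤ ε) {M q : ℕ}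
    {f : ℕ → ℂ} (hf : ∀ k, f k ≠ 0 → ∃ h, h < q ∧ k = (h + 1) * M ∧ ‖f k‖ ≤ ρ ^ (h + 1)) :
    NormBound X f ε := by
  have hsum : NormBound X (∑ h ∈ Finset.range q, Pi.single ((h + 1) * M) ((ρ : ℂ) ^ (h + 1)))
      (∑ h ∈ Finset.range q, ρ ^ (h + 1)) := NormBound.sum _ fun h _ =>
    (normBound_single ((h + 1) * M) ((ρ : ℂ) ^ (h + 1))).mono (fun _ => le_rfl)
      (by rw [norm_pow, Complex.norm_real, Real.norm_of_nonneg hρ0])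
  refine hsum.mono (fun k => ?_) ?_
  · by_cases hk : f k = 0
    · rw [hk, norm_zero]
      exact norm_nonneg _
    obtain ⟨h, hq, rfl, hle⟩ := hf k hk
    refine hle.trans ?_
    have e1 : (∑ j ∈ Finset.range q, Pi.single ((j + 1) * M) ((ρ : ℂ) ^ (j + 1))
        : ℕ → ℂ) ((h + 1) * M)
        = ((∑ j ∈ Finset.range q,
          if (h + 1) * M = (j + 1) * M then ρ ^ (j + 1) else 0 : ℝ) : ℂ) := by
      rw [Finset.sum_apply, Complex.ofReal_sum]
      refine Finset.sum_congr rfl fun j _ => ?_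
      rw [Pi.single_apply]
      split_ifs <;> simp
    have hpos : ∀ j ∈ Finset.range q,
        0 ≤ (if (h + 1) * M = (j + 1) * M then ρ ^ (j + 1) else 0 : ℝ) := fun j _ => by
      split_ifs <;> positivity
    rw [e1, Complex.norm_real, Real.norm_of_nonneg (Finset.sum_nonneg hpos)]
    refine le_trans ?_ (Finset.single_le_sum hpos (Finset.mem_range.2 hq))
    rw [if_pos rfl]
  · have e1 : ∀ q : ℕ, ∑ h ∈ Finset.range q, ρ ^ (h + 1) ≤ 2 * ρ - 2 * ρ ^ (q + 1) := fun q => by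
      induction q with
      | zero => simp
      | succ q ih =>
        rw [Finset.sum_range_succ]
        have : ρ ^ (q + 1 + 1) ≤ ρ ^ (q + 1) * (1 / 2) := by
          rw [pow_succ ρ (q + 1)]
          gcongr
        linarith
    linarith [e1 q, pow_nonneg hρ0 (q + 1)]

/-- The points `s + ∑_{i < r} c / (n₁ + i M)` of the parameter interval. -/
def harmonicTime (s c : ℝ) (n₁ M : ℕ) (r : ℕ) : ℝ :=
  s + ∑ i ∈ Finset.range r, c / ((n₁ + i * M : ℕ) : ℝ)

lemma harmonicTime_succ (s c : ℝ) (n₁ M r : ℕ) :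
    harmonicTime s c n₁ M (r + 1) = harmonicTime s c n₁ M r + c / ((n₁ + r * M : ℕ) : ℝ) := by
  rw [harmonicTime, harmonicTime, Finset.sum_range_succ, add_assoc]

lemma harmonicTime_mono {s c : ℝ} (hc : 0 ≤ c) (n₁ M : ℕ) : Monotone (harmonicTime s c n₁ M) :=
  monotone_nat_of_le_succ fun r => by
    rw [harmonicTime_succ]
    exact le_add_of_nonneg_right (by positivity)

lemma harmonicTime_add_le {s c : ℝ} (hc : 0 ≤ c) {n₁ M : ℕ} (h₁ : 1 ≤ n₁) (r h : ℕ) :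
    harmonicTime s c n₁ M (r + h)
      ≤ harmonicTime s c n₁ M r + h * (c / ((n₁ + r * M : ℕ) : ℝ)) := by
  induction h with
  | zero => simp
  | succ h ih =>
    rw [← add_assoc, harmonicTime_succ]
    have : c / ((n₁ + (r + h) * M : ℕ) : ℝ) ≤ c / ((n₁ + r * M : ℕ) : ℝ) := by
      have : 0 < ((n₁ + r * M : ℕ) : ℝ) := by positivity
      gcongr
      omega
    push_cast at *
    linarith

lemma exists_lt_harmonicTime {s c : ℝ} (hc : 0 < c) {n₁ M : ℕ} (h₁ : 1 ≤ n₁) (t : ℝ) :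
    ∃ r, t < harmonicTime s c n₁ M r := by
  have hle : ∀ r, s + c / (n₁ + M) * ∑ i ∈ Finset.range r, (1 : ℝ) / (i + 1)
      ≤ harmonicTime s c n₁ M r := fun r => by
    rw [harmonicTime, Finset.mul_sum]
    gcongr with i
    rw [div_mul_div_comm, mul_one]
    gcongr
    push_cast
    have : (1 : ℝ) ≤ n₁ := by exact_mod_cast h₁
    nlinarith [(Nat.cast_nonneg i : (0 : ℝ) ≤ i), (Nat.cast_nonneg M : (0 : ℝ) ≤ M)]
  have hpos : 0 < c / ((n₁ : ℝ) + M) := by positivity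
  have h := Real.tendsto_sum_range_one_div_nat_succ_atTop.const_mul_atTop hpos
  obtain ⟨r, hr⟩ := (h.eventually_gt_atTop (t - s)).exists
  exact ⟨r, by linarith [hle r]⟩

/-- A compact arc of a Lipschitz curve is coverable for `φ(n) = n`: take the times `n₁ + r M` in
arithmetic progression. By divergence of the harmonic series, boxes of side comparable to
`1 / (n₁ + r M)`, met in the order of the curve, exhaust the arc; and the Lipschitz bound keeps the
drift of the parameter between two times below the decay due to the gap between them. -/
theorem coverable_image_Icc {d : ℕ} {g : ℝ → Fin d → ℝ} {L : ℝ≥0} {s t a : ℝ} (hst : s ≤ t)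
    (hg : LipschitzOnWith L g (Set.Icc s t)) (ha : 0 < a)
    (hga : ∀ y ∈ Set.Icc s t, ∀ i, a ≤ g y i) :
    Coverable X (fun n : ℕ => (n : ℝ)) (g '' Set.Icc s t) := by
  classical
  intro N n₀ ε hN hε
  set τ : ℝ := min (a / 4) (min 1 (ε / 2)) with hτ
  have hτ0 : 0 < τ := by positivity
  have hτa : τ ≤ a / 4 := min_le_left _ _
  have hτ1 : τ ≤ 1 := (min_le_right _ _).trans (min_le_left _ _)
  have hτε : τ ≤ ε / 2 := (min_le_right _ _).trans (min_le_right _ _)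
  obtain ⟨M, hMN, hM1, hM2⟩ : ∃ M : ℕ, N ≤ M ∧ Real.exp (-(a / 2 * M)) ≤ 1 / 2 ∧
      2 * Real.exp (-(a / 2 * M)) ≤ ε := by
    have h1 : Filter.Tendsto (fun M : ℕ => Real.exp (-(a / 2 * M))) Filter.atTop (nhds 0) :=
      Real.tendsto_exp_neg_atTop_nhds_zero.comp
        (tendsto_natCast_atTop_atTop.const_mul_atTop (half_pos ha))
    obtain ⟨M, h⟩ := ((Filter.eventually_ge_atTop N).and
      (h1.eventually (ge_mem_nhds (lt_min one_half_pos (half_pos hε))))).exists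
    exact ⟨M, h.1, h.2.trans (min_le_left _ _), by linarith [h.2.trans (min_le_right _ _)]⟩
  have hM0 : 1 ≤ M := hN.trans hMN
  set ρ := Real.exp (-(a / 2 * M))
  set n₁ := n₀ + 1 with hn₁
  have h₁ : 1 ≤ n₁ := by omega
  set c : ℝ := τ / (L + 1) with hc
  have hc0 : 0 < c := by positivity
  have hLc : L * c ≤ τ := by
    rw [hc, mul_div_assoc', div_le_iff₀ (by positivity)]
    nlinarith [L.coe_nonneg]
  let p : ℕ → ℝ := harmonicTime s c n₁ M
  have hpmono : Monotone p := harmonicTime_mono hc0.le n₁ M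
  have hps : ∀ r, s ≤ p r := fun r => by
    have : p 0 = s := by simp [p, harmonicTime]
    rw [← this]
    exact hpmono r.zero_le
  obtain ⟨q, hq⟩ := exists_lt_harmonicTime (s := s) (M := M) hc0 h₁ t
  have hmem : ∀ r, min (p r) t ∈ Set.Icc s t := fun r => ⟨le_min (hps r) hst, min_le_right _ _⟩
  let μ : ℕ → Fin d → ℝ := fun n => g (min (p ((n - n₁) / M)) t)
  have hμ : ∀ r, μ (n₁ + r * M) = g (min (p r) t) := fun r => by
    simp only [μ, Nat.add_sub_cancel_left, Nat.mul_div_cancel _ hM0]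
  let F : Finset ℕ := (Finset.range (q + 1)).image fun r => n₁ + r * M
  have hF : ∀ n ∈ F, ∃ r < q + 1, n = n₁ + r * M := fun n hn => by
    obtain ⟨r, hr, rfl⟩ := Finset.mem_image.1 hn
    exact ⟨r, Finset.mem_range.1 hr, rfl⟩
  refine ⟨F, μ, fun n hn => ?_, fun n hn => ?_, fun n hn n' hn' hlt => ?_, ?_⟩
  · obtain ⟨r, -, rfl⟩ := hF n hn
    omega
  · obtain ⟨r, -, rfl⟩ := hF n hn
    rw [hμ]
    exact Set.mem_image_of_mem _ (hmem r)
  · obtain ⟨r, -, rfl⟩ := hF n hn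
    obtain ⟨r', -, rfl⟩ := hF n' hn'
    have h1 : r + 1 ≤ r' := by
      by_contra! h
      have := Nat.mul_le_mul_right M (Nat.lt_succ_iff.1 h)
      omega
    have := Nat.mul_le_mul_right M h1
    rw [add_mul] at this
    omega
  rintro _ ⟨y, hy, rfl⟩
  have hex : ∃ r, y < p (r + 1) := ⟨q, hy.2.trans_lt (hq.trans_le (hpmono q.le_succ))⟩
  set r := Nat.find hex with hr
  have hr1 : y < p (r + 1) := Nat.find_spec hex
  have hr0 : p r ≤ y := by
    rcases Nat.eq_zero_or_eq_succ_pred r with h | h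
    · rw [h]
      simpa [p, harmonicTime] using hy.1
    · rw [h]
      exact not_lt.1 (Nat.find_min hex (m := r.pred) (by omega))
  have hrq : r < q + 1 :=
    Nat.lt_succ_iff.2 (Nat.find_min' hex (hy.2.trans_lt (hq.trans_le (hpmono q.le_succ))))
  set n := n₁ + r * M with hn
  have hn0 : (0 : ℝ) < n := by
    have : 0 < n := by omega
    exact_mod_cast this
  -- The parameter drifts by at most `(h + 1) τ / n` in `h` steps.
  have hdrift : ∀ h i, |g y i - μ (n₁ + (r + h) * M) i| * n ≤ (h + 1) * τ := fun h i => by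
    have h1 : |y - min (p (r + h)) t| ≤ (h + 1) * (c / n) := by
      have e1 : p (r + h) ≤ p r + h * (c / n) := harmonicTime_add_le hc0.le h₁ r h
      have e2 : p (r + 1) = p r + c / n := harmonicTime_succ ..
      have e3 : 0 ≤ c / n := by positivity
      have e4 : p r ≤ p (r + h) := hpmono (Nat.le_add_right r h)
      have e5 : p r ≤ min (p (r + h)) t := le_min e4 (hr0.trans hy.2)
      have e6 : 0 ≤ h * (c / n) := by positivity
      rw [abs_le]
      constructor
      · linarith [min_le_left (p (r + h)) t]
      · linarith
    have h2 := hg.dist_le_mul y hy _ (hmem (r + h))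
    have h3 := (dist_le_pi_dist _ _ i).trans h2
    rw [Real.dist_eq, Real.dist_eq, ← hμ] at h3
    calc _ ≤ L * ((h + 1) * (c / n)) * n := by gcongr; exact h3.trans (by gcongr)
      _ = (h + 1) * (L * c) := by field_simp
      _ ≤ _ := by gcongr
  refine ⟨n, Finset.mem_image_of_mem _ (Finset.mem_range.2 hrq), fun i => ⟨?_, ?_⟩⟩
  · have h1 := hdrift 0 i
    rw [add_zero, Nat.cast_zero, zero_add, one_mul] at h1
    have h2 : |(g y i - μ n i) * n| ≤ τ := by rwa [abs_mul, abs_of_pos hn0]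
    exact (Real.abs_exp_sub_one_le (h2.trans hτ1)).trans (by linarith)
  · refine normBound_of_le_pow (Real.exp_pos _).le hM1 hM2 (M := M) (q := q + 1) fun k hk => ?_
    have hk' : k ≠ 0 ∧ n + k ∈ F := by
      by_contra h
      exact hk (by rw [tailSeq, if_neg h, Complex.ofReal_zero])
    obtain ⟨r', hr', hnk⟩ := hF _ hk'.2
    have hrr : r < r' := by
      by_contra! h
      have := Nat.mul_le_mul_right M h
      omega
    obtain ⟨h, rfl⟩ := Nat.exists_eq_add_of_lt hrr
    have hkM : k = (h + 1) * M := by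
      have : (r + h + 1) * M = r * M + (h + 1) * M := by ring
      omega
    refine ⟨h, by omega, hkM, ?_⟩
    rw [Complex.norm_real, Real.norm_of_nonneg (tailSeq_nonneg ..), tailSeq, if_pos hk',
      ← Real.exp_nat_mul, Real.exp_le_exp]
    have h1 := (abs_le.1 (le_refl |g y i - μ (n + k) i|)).2
    have h2 := hdrift (h + 1) i
    rw [← add_assoc, ← hnk] at h2
    have h3 : a ≤ μ (n + k) i := by
      rw [hnk, hμ]
      exact hga _ (hmem _) i
    have h4 := mul_le_mul_of_nonneg_right h1 hn0.le
    have h5 : a * ((h + 1 : ℕ) * M) ≤ μ (n + k) i * ((h + 1 : ℕ) * M) := by gcongr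
    have h6 : ((n + k : ℕ) : ℝ) = n + (h + 1 : ℕ) * M := by
      rw [hkM]
      push_cast
      ring
    have h7 : (k : ℝ) = (h + 1 : ℕ) * M := by exact_mod_cast hkM
    have h8 : (1 : ℝ) ≤ M := by exact_mod_cast hM0
    -- Twice the drift is at most the decay `a k` caused by the gap `k = (h + 1) M`.
    have h9 : ((h + 1 : ℕ) + 1) * τ ≤ (h + 1 : ℕ) * (a / 2 * M) := by
      have e1 : ((h + 1 : ℕ) + 1 : ℝ) ≤ 2 * (h + 1 : ℕ) := by
        push_cast
        linarith [(Nat.cast_nonneg h : (0 : ℝ) ≤ h)]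
      calc ((h + 1 : ℕ) + 1 : ℝ) * τ ≤ 2 * (h + 1 : ℕ) * (a / 4) := by gcongr
        _ = (h + 1 : ℕ) * (a / 2 * 1) := by ring
        _ ≤ _ := by gcongr
    rw [h6, h7]
    linarith

/-- The points of an interval are covered by countably many compact intervals with endpoints in
it. -/
lemma exists_countable_endpoints {J : Set ℝ} (hJ : J.OrdConnected) :
    ∃ D : Set ℝ, D.Countable ∧ D ⊆ J ∧ ∀ x ∈ J, ∃ s ∈ D, ∃ t ∈ D, x ∈ Set.Icc s t := by
  refine ⟨J ∩ (Set.range ((↑) : ℚ → ℝ) ∪ {x | IsLeast J x} ∪ {x | IsGreatest J x}), ?_,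
    Set.inter_subset_left, fun x hx => ?_⟩
  · refine Set.Countable.mono Set.inter_subset_right (((Set.countable_range _).union ?_).union ?_)
    · exact Set.Subsingleton.countable fun x hx y hy => hx.unique hy
    · exact Set.Subsingleton.countable fun x hx y hy => hx.unique hy
  · obtain ⟨s, hs, hsx⟩ : ∃ s ∈ J ∩ (Set.range ((↑) : ℚ → ℝ) ∪ {x | IsLeast J x} ∪
        {x | IsGreatest J x}), s ≤ x := by
      by_cases h : ∃ y ∈ J, y < x
      · obtain ⟨y, hy, hyx⟩ := h
        obtain ⟨q, h1, h2⟩ := exists_rat_btwn hyx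
        exact ⟨q, ⟨hJ.out hy hx ⟨h1.le, h2.le⟩, Or.inl (Or.inl ⟨q, rfl⟩)⟩, h2.le⟩
      · push Not at h
        exact ⟨x, ⟨hx, Or.inl (Or.inr ⟨hx, h⟩)⟩, le_rfl⟩
    obtain ⟨t, ht, hxt⟩ : ∃ t ∈ J ∩ (Set.range ((↑) : ℚ → ℝ) ∪ {x | IsLeast J x} ∪
        {x | IsGreatest J x}), x ≤ t := by
      by_cases h : ∃ y ∈ J, x < y
      · obtain ⟨y, hy, hxy⟩ := h
        obtain ⟨q, h1, h2⟩ := exists_rat_btwn hxy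
        exact ⟨q, ⟨hJ.out hx hy ⟨h1.le, h2.le⟩, Or.inl (Or.inl ⟨q, rfl⟩)⟩, h1.le⟩
      · push Not at h
        exact ⟨x, ⟨hx, Or.inr ⟨hx, h⟩⟩, le_rfl⟩
    exact ⟨s, hs, t, ht, hsx, hxt⟩

lemma abs_log_sub_log_le {x y : ℝ} (hx : 1 ≤ x) (hy : 1 ≤ y) :
    |Real.log x - Real.log y| ≤ |x - y| := by
  wlog hxy : y ≤ x generalizing x y
  · rw [abs_sub_comm, abs_sub_comm x]
    exact this hy hx (le_of_not_ge hxy)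
  have hy0 : 0 < y := by linarith
  rw [abs_of_nonneg (sub_nonneg.2 (Real.log_le_log hy0 hxy)), abs_of_nonneg (sub_nonneg.2 hxy),
    ← Real.log_div (by linarith) hy0.ne']
  refine (Real.log_le_sub_one_of_pos (div_pos (by linarith) hy0)).trans ?_
  rw [div_sub_one hy0.ne', div_le_iff₀ hy0]
  nlinarith

theorem hasCommonHypercyclicAlgebra_of_isLipschitzCurve [CompleteSpace X] {T : ℝ → X →L[ℂ] X}
    (hT : IsShiftFamily (fun n : ℕ => (n : ℝ)) T) {Γ : Set (Fin 2 → ℝ)} (hΓ : IsLipschitzCurve Γ)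
    (hΓ1 : ∀ l ∈ Γ, ∀ i, 1 < l i) :
    HasCommonHypercyclicAlgebra (X := Fin 2 → X) Γ
      (fun l => prodOperator fun i => T (Real.log (l i))) := by
  obtain ⟨J, f, L, hJ, -, hf, rfl⟩ := hΓ
  obtain ⟨D, hD, hDJ, hJD⟩ := exists_countable_endpoints hJ
  have := hD.to_subtype
  let g : ℝ → Fin 2 → ℝ := fun y i => Real.log (f y i)
  have hf1 : ∀ y ∈ J, ∀ i, 1 < f y i := fun y hy => hΓ1 _ (Set.mem_image_of_mem f hy)
  have hg : LipschitzOnWith L g J := LipschitzOnWith.of_dist_le_mul fun y hy z hz => by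
    refine le_trans ?_ (hf.dist_le_mul y hy z hz)
    refine (dist_pi_le_iff dist_nonneg).2 fun i => le_trans ?_ (dist_le_pi_dist (f y) (f z) i)
    exact abs_log_sub_log_le (hf1 y hy i).le (hf1 z hz i).le
  let ι := {q : D × D // (q.1 : ℝ) ≤ q.2}
  have hsub : ∀ q : ι, Set.Icc (q.1.1 : ℝ) q.1.2 ⊆ J := fun q =>
    hJ.out (hDJ q.1.1.2) (hDJ q.1.2.2)
  let K : ι → Set (Fin 2 → ℝ) := fun q => g '' Set.Icc (q.1.1 : ℝ) q.1.2
  have hK : ∀ q, IsCompact (K q) := fun q =>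
    isCompact_Icc.image_of_continuousOn (hg.continuousOn.mono (hsub q))
  have hpos : ∀ q, ∀ s ∈ K q, ∀ i, 0 < s i := by
    rintro q _ ⟨y, hy, rfl⟩ i
    exact Real.log_pos (hf1 y (hsub q hy) i)
  have hcov : ∀ q, Coverable X (fun n : ℕ => (n : ℝ)) (K q) := fun q => by
    obtain ⟨a, _, ha, _, hab⟩ := exists_bounds_of_isCompact (hK q) (hpos q)
    exact coverable_image_Icc q.2 (hg.mono (hsub q)) ha
      fun y hy i => (hab _ (Set.mem_image_of_mem g hy) i).1
  obtain ⟨A, hA, h⟩ := hasCommonHypercyclicAlgebra_of_coverable isGrowth_natCast hT one_le_two K hK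
    hpos hcov
  refine ⟨A, hA, fun x hx hx0 => ?_⟩
  rintro _ ⟨y, hy, rfl⟩
  obtain ⟨s, hs, t, ht, hst⟩ := hJD y hy
  exact h x hx hx0 (g y) (Set.mem_iUnion.2
    ⟨⟨(⟨s, hs⟩, ⟨t, ht⟩), hst.1.trans hst.2⟩, Set.mem_image_of_mem g hst⟩)

end Lipschitz

/-! ### The shifts on `ℓ_p` and `c_0` -/

lemma weight_succ_eq {α : ℝ} (hα : α ∈ Set.Ioc (0 : ℝ) 1) {w : AdmissibleWeight} {a : ℝ}
    (hw : ∀ n : ℕ, 1 ≤ n → ∏ k ∈ Finset.Icc 1 n, w k = Real.exp (a * (n : ℝ) ^ α)) (k : ℕ) :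
    w (k + 1) = Real.exp (a * (((k + 1 : ℕ) : ℝ) ^ α - (k : ℝ) ^ α)) := by
  have h0 : ∏ j ∈ Finset.Icc 1 k, w j = Real.exp (a * (k : ℝ) ^ α) := by
    rcases Nat.eq_zero_or_pos k with rfl | hk
    · simp [Real.zero_rpow hα.1.ne']
    · exact hw k hk
  have h1 := hw (k + 1) (by omega)
  rw [Finset.prod_Icc_succ_top (by omega), h0] at h1
  rw [mul_sub, Real.exp_sub, ← h1, mul_div_cancel_left₀ _ (Real.exp_pos _).ne']

lemma isShiftFamily_of_weights {X : Type*} [NonUnitalNormedRing X] [NormedSpace ℂ X]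
    [SequenceAlgebra X] {α : ℝ} (hα : α ∈ Set.Ioc (0 : ℝ) 1) {w : ℝ → AdmissibleWeight}
    (hw : ∀ (a : ℝ) (n : ℕ), 1 ≤ n → ∏ k ∈ Finset.Icc 1 n, w a k = Real.exp (a * (n : ℝ) ^ α))
    {S : AdmissibleWeight → X →L[ℂ] X}
    (hS : ∀ w x k, coord (S w x) k = (w (k + 1) : ℂ) * coord x (k + 1)) :
    IsShiftFamily (fun n : ℕ => (n : ℝ) ^ α) fun a => S (w a) := fun a x k => by
  rw [hS, weight_succ_eq hα (hw a)]

lemma isShiftFamily_exp_smul {X : Type*} [NonUnitalNormedRing X] [NormedSpace ℂ X]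
    [SequenceAlgebra X] {S : AdmissibleWeight → X →L[ℂ] X}
    (hS : ∀ w x k, coord (S w x) k = (w (k + 1) : ℂ) * coord x (k + 1)) :
    IsShiftFamily (fun n : ℕ => (n : ℝ)) fun a => (Real.exp a : ℂ) • S AdmissibleWeight.one :=
  fun a x k => by
    have h : (AdmissibleWeight.one (k + 1) : ℝ) = 1 := rfl
    rw [smul_apply, map_smul, Pi.smul_apply, hS, h]
    simp

/-- Multiples of the backward shift along a Lipschitz curve, on any sequence algebra. -/
theorem hasCommonHypercyclicAlgebra_smul_shift {X : Type*} [NonUnitalNormedRing X]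
    [NormedSpace ℂ X] [SequenceAlgebra X] [CompleteSpace X] {S : AdmissibleWeight → X →L[ℂ] X}
    (hS : ∀ w x k, coord (S w x) k = (w (k + 1) : ℂ) * coord x (k + 1)) {Γ : Set (Fin 2 → ℝ)}
    (hΓ : IsLipschitzCurve Γ) (hΓ1 : ∀ l ∈ Γ, ∀ i, 1 < l i) :
    HasCommonHypercyclicAlgebra (X := Fin 2 → X) Γ
      (fun l => prodOperator fun i => (l i : ℂ) • S AdmissibleWeight.one) := by
  obtain ⟨A, hA, h⟩ := hasCommonHypercyclicAlgebra_of_isLipschitzCurve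
    (isShiftFamily_exp_smul hS) hΓ hΓ1
  refine ⟨A, hA, fun x hx hx0 l hl => ?_⟩
  have := h x hx hx0 l hl
  have hexp : ∀ i, Real.exp (Real.log (l i)) = l i := fun i =>
    Real.exp_log (one_pos.trans (hΓ1 l hl i))
  simpa only [hexp] using this

end CommonHypercyclic

end

open CommonHypercyclic in
theorem mainTheorem6 :
    -- common hypercyclic vector iff common hypercyclic algebra, on `ℓ_p` and on `c_0`
    (∀ (d : ℕ) (_ : 1 ≤ d) (α : ℝ) (_ : α ∈ Set.Ioc (0 : ℝ) 1)
      (w : ℝ → AdmissibleWeight)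
      (_ : ∀ (a : ℝ) (n : ℕ), 1 ≤ n →
        ∏ k ∈ Finset.Icc 1 n, w a k = Real.exp (a * (n : ℝ) ^ α))
      (Λ : Set (Fin d → ℝ)) (_ : IsSigmaCompact Λ),
      (∀ (p : ℝ≥0∞) [Fact (1 ≤ p)] [Fact (p ≠ ∞)],
        HasCommonHypercyclicVector (X := Fin d → Ellp p) Λ
            (fun l => prodOperator fun i => shiftEllp (w (l i))) ↔
          HasCommonHypercyclicAlgebra (X := Fin d → Ellp p) Λ
            (fun l => prodOperator fun i => shiftEllp (w (l i)))) ∧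
      (HasCommonHypercyclicVector (X := Fin d → Czero) Λ
          (fun l => prodOperator fun i => shiftCzero (w (l i))) ↔
        HasCommonHypercyclicAlgebra (X := Fin d → Czero) Λ
          (fun l => prodOperator fun i => shiftCzero (w (l i))))) ∧
    -- the family `l 0 • B × l 1 • B`, indexed by a Lipschitz curve in `(1, ∞) ^ 2`
    (∀ (Γ : Set (Fin 2 → ℝ)) (_ : IsLipschitzCurve Γ) (_ : ∀ l ∈ Γ, ∀ i, 1 < l i),
      (∀ (p : ℝ≥0∞) [Fact (1 ≤ p)] [Fact (p ≠ ∞)],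
        HasCommonHypercyclicVector (X := Fin 2 → Ellp p) Γ
            (fun l => prodOperator fun i => (l i : ℂ) • shiftEllp AdmissibleWeight.one) ∧
          HasCommonHypercyclicAlgebra (X := Fin 2 → Ellp p) Γ
            (fun l => prodOperator fun i => (l i : ℂ) • shiftEllp AdmissibleWeight.one)) ∧
      (HasCommonHypercyclicVector (X := Fin 2 → Czero) Γ
          (fun l => prodOperator fun i => (l i : ℂ) • shiftCzero AdmissibleWeight.one) ∧
        HasCommonHypercyclicAlgebra (X := Fin 2 → Czero) Γ
          (fun l => prodOperator fun i => (l i : ℂ) • shiftCzero AdmissibleWeight.one))) := by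
  
  refine ⟨fun d hd α hα w hw Λ hΛ => ⟨fun p _ _ => ?_, ?_⟩,
    fun Γ hΓ hΓ1 => ⟨fun p _ _ => ?_, ?_⟩⟩
  · exact hasCommonHypercyclicVector_iff_algebra (isGrowth_rpow hα)
      (isShiftFamily_of_weights hα hw (S := shiftEllp (p := p)) fun _ _ _ => rfl) hd hΛ
  · exact hasCommonHypercyclicVector_iff_algebra (isGrowth_rpow hα)
      (isShiftFamily_of_weights hα hw (S := shiftCzero) fun _ _ _ => rfl) hd hΛ
  · have h := hasCommonHypercyclicAlgebra_smul_shift (S := shiftEllp (p := p))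
      (fun _ _ _ => rfl) hΓ hΓ1
    exact ⟨h.hasCommonHypercyclicVector, h⟩
  · have h := hasCommonHypercyclicAlgebra_smul_shift (S := shiftCzero) (fun _ _ _ => rfl) hΓ hΓ1
    exact ⟨h.hasCommonHypercyclicVector, h⟩
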